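/- Conventions. Let $G$ be a connected Lie group with Lie algebra $\mathfrak g$, and $H\subset G$ a closed connected subgroup with Lie algebra $\mathfrak h$. The coadjoint action is $\langle xp,\xi\rangle=\langle p,\mathrm{Ad}(x^{-1})\xi\rangle$. Let $O\subset\mathfrak h^*$ be a coadjoint orbit of $H$, with its smooth structure as a homogeneous space of $H$ and the orbit form $\omega_O(\mathrm{ad}^*_\xi\theta,\mathrm{ad}^*_\eta\theta)=-\langle\theta,[\xi,\eta]\rangle$. Let $(S,\omega)$ be a symplectic manifold with a strongly Hamiltonian right action of $G$, i.e. a smooth action preserving $\omega$, with a smooth moment map $J:S\to\mathfrak g^*$ such that $dJ_\xi=\omega(\cdot,\xi_S)$, where $\xi_S(s)=\frac{d}{dt}\big|_{0}\,s\exp(t\xi)$, and $J(sx)=x^{-1}J(s)$; restricting to $H$ gives the moment map $J_H=J|_{\mathfrak h}:S\to\mathfrak h^*$. We also write $xs$ for $sx^{-1}$. In the left trivialization $T^*G\simeq G\times\mathfrak g^*$, with symplectic form $d\theta_L$, $\theta_L$ the Liouville form, $G$ acts from the left by $y(x,p)=(yx,p)$ with moment map $J_L(x,p)=xp$, and $H$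 acts from the right by $(x,p)h=(xh,h^{-1}p)$ with moment map $J_R(x,p)=p|_{\mathfrak h}$. For a right Hamiltonian $H$-space $Y$ with moment map $J_Y$, put $Y^{O}=J_Y^{-1}(O)/H$, where $J_Y^{-1}(O)$ is identified with $\{(y,\theta)\in Y\times O: J_Y(y)=\theta\}$. A reduced symplectic structure on this set is a (Hausdorff, second countable) manifold structure and a symplectic form on it such that the projection from $J_Y^{-1}(O)$ is smooth, has smooth local sections through every point, and pulls the form back to the restriction of $\omega_Y+\omega_O$. Let $(T^*G)^O=J_R^{-1}(O)/H$ be the reduced symplectic manifold, with points $[x,p]_H$, left $G$-action $y[x,p]_H=[yx,p]_H$ and moment map $J_L^O([x,p]_H)=xp$. Let $$S^{(T^*G)^O}=\{(s,z)\in S\times(T^*G)^O: J(s)=J_L^O(z)\}/G ,\qquad x:(s,z)\mapsto(sx,x^{-1}z);$$ a reduced symplectic structure on it is defined in the same way, with the form on $S\times(T^*G)^O$. Corollary (Marsden-Weinstein reduction in stages). The formula $W([s,[x,p]_H])=[x^{-1}s]_H=[sx]_H$ (where $p|_{\mathfrak h}\in O$ and $J(s)=xp$) gives a well-defined bijection $W:S^{(T^*G)^O}\to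 S^O=J_H^{-1}(O)/H$. One of the two sets admits a reduced symplectic structure if and only if the other one does, and in that case $W$ is a symplectomorphism. In the notation with $\theta=p|_{\mathfrak h}\in O$, $W([s,x,p,\theta])=[x^{-1}s]_H$. -/

import Mathlib

open scoped Manifold ContDiff

noncomputable section

namespace SymplecticInduction

/-! ### Differential forms and symplectic forms on manifolds -/

section Forms

variable {E : Type*} [NormedAddCommGroup E] [NormedSpace ℝ E] {B : Type*} [TopologicalSpace B]
  (I : ModelWithCorners ℝ E B) (M : Type*) [TopologicalSpace M] [ChartedSpace B M]

/-- A (not necessarily smooth) differential `k`-form on `M`. -/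
abbrev DiffForm (k : ℕ) : Type _ := ∀ x : M, TangentSpace I x [⋀^Fin k]→L[ℝ] ℝ

variable {I M} {k : ℕ}

/-- The expression of the form `Ω` in the preferred chart at `x₀`, i.e. the pull-back of `Ω` by the
inverse of that chart (meaningful on the target of the chart). -/
def inChart (Ω : DiffForm I M k) (x₀ : M) (y : E) : E [⋀^Fin k]→L[ℝ] ℝ :=
  (Ω ((extChartAt I x₀).symm y)).compContinuousLinearMap
    (mfderiv 𝓘(ℝ, E) I (extChartAt I x₀).symm y)

/-- A form is smooth if its expressions in charts are (`M` without boundary). -/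
def IsSmoothForm (Ω : DiffForm I M k) : Prop :=
  ∀ x₀ : M, ContDiffOn ℝ ∞ (inChart Ω x₀) (extChartAt I x₀).target

/-- The exterior derivative of a form (`M` without boundary), computed at `x` in the preferred
chart at `x`. -/
def extD (Ω : DiffForm I M k) : DiffForm I M (k + 1) := fun x =>
  (extDeriv (inChart Ω x) (extChartAt I x x)).compContinuousLinearMap
    (mfderiv I 𝓘(ℝ, E) (extChartAt I x) x)

/-- Symplectic forms: smooth, closed, nondegenerate 2-forms. -/
structure IsSymplectic (Ω : DiffForm I M 2) : Prop where
  smooth : IsSmoothForm Ω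
  closed : ∀ x, extD Ω x = 0
  nondegenerate : ∀ x (v : TangentSpace I x), (∀ w : TangentSpace I x, Ω x ![v, w] = 0) → v = 0

end Forms

/-- A map between manifolds with 2-forms is a symplectomorphism: a smooth bijection with smooth
inverse which pulls `Ω'` back to `Ω`. -/
structure IsSymplectomorphism {E : Type*} [NormedAddCommGroup E] [NormedSpace ℝ E]
    {B : Type*} [TopologicalSpace B] {I : ModelWithCorners ℝ E B}
    {M : Type*} [TopologicalSpace M] [ChartedSpace B M]
    {E' : Type*} [NormedAddCommGroup E'] [NormedSpace ℝ E']
    {B' : Type*} [TopologicalSpace B'] {I' : ModelWithCorners ℝ E' B'}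
    {M' : Type*} [TopologicalSpace M'] [ChartedSpace B' M']
    (Ω : DiffForm I M 2) (Ω' : DiffForm I' M' 2) (f : M ≃ M') : Prop where
  smooth : ContMDiff I I' ∞ f
  smooth_symm : ContMDiff I' I ∞ f.symm
  pullback : ∀ x, (Ω' (f x)).compContinuousLinearMap (mfderiv I I' f x) = Ω x

/-! ### Lie groups, coadjoint action, moment maps -/

section LieGroups

variable {E : Type*} [NormedAddCommGroup E] [NormedSpace ℝ E]
  {G : Type*} [Group G] [TopologicalSpace G] [ChartedSpace E G]

/-- The adjoint action of `x` on the Lie algebra `T_1 G` (which is, by definition, the model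
space `E` as a vector space): the derivative at `1` of conjugation by `x`. -/
def Ad (x : G) : E →L[ℝ] E := mfderiv 𝓘(ℝ, E) 𝓘(ℝ, E) (fun y : G => x * y * x⁻¹) 1

/-- The coadjoint action of `x` on the dual of the Lie algebra, `⟨x p, ξ⟩ = ⟨p, Ad(x⁻¹) ξ⟩`. -/
def coAd (x : G) (p : E →L[ℝ] ℝ) : E →L[ℝ] ℝ := p.comp (Ad x⁻¹)

variable (G) in
/-- The Lie bracket of the Lie algebra of `G`. -/
def lieBr (ξ η : E) : E :=
  (⁅(show GroupLieAlgebra 𝓘(ℝ, E) G from ξ), (show GroupLieAlgebra 𝓘(ℝ, E) G from η)⁆ :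
    GroupLieAlgebra 𝓘(ℝ, E) G)

/-- The left translation `v ↦ x⁻¹ v` from the tangent space at `x` to the Lie algebra. -/
def leftTriv (x : G) : TangentSpace 𝓘(ℝ, E) x →L[ℝ] E :=
  mfderiv 𝓘(ℝ, E) 𝓘(ℝ, E) (fun y : G => x⁻¹ * y) x

variable (G) in
/-- The coadjoint orbits of `G`. -/
def IsCoadjointOrbit (O : Set (E →L[ℝ] ℝ)) : Prop :=
  ∃ μ : E →L[ℝ] ℝ, O = {θ | ∃ x : G, θ = coAd x μ}

variable (G) in
/-- The vector `a` of `𝔤*` is the value at `θ` of the vector field generated by `ξ` under the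
coadjoint action: `a = ad*_ξ θ`, i.e. `a(ζ) = -θ([ξ, ζ])` for all `ζ`. -/
def IsCoadVector (ξ : E) (θ a : E →L[ℝ] ℝ) : Prop :=
  ∀ ζ : E, a ζ = -θ (lieBr G ξ ζ)

variable (G) in
/-- The map `θ`, defined on a manifold `N`, is on the open set `U` a smooth map into the coadjoint
orbit `O`, where `O` has its smooth structure as a homogeneous space of `G` (not the topology
of a subset of `𝔤*`): locally `θ` is obtained by letting a smooth function with values in `G`
act on a point of `O`. -/
def IsSmoothIntoOrbit {F : Type*} [NormedAddCommGroup F] [NormedSpace ℝ F]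
    {N : Type*} [TopologicalSpace N] [ChartedSpace F N]
    (O : Set (E →L[ℝ] ℝ)) (θ : N → E →L[ℝ] ℝ) (U : Set N) : Prop :=
  ∀ u ∈ U, ∃ V : Set N, IsOpen V ∧ u ∈ V ∧ ∃ μ ∈ O, ∃ x : N → G,
    ContMDiffOn 𝓘(ℝ, F) 𝓘(ℝ, E) ∞ x V ∧ ∀ u' ∈ V, θ u' = coAd (x u') μ

/-- The vector field `ξ_S` on `S` generated by `ξ` under a right action of `G`, i.e. the derivative of
`s exp(tξ)` at `t = 0`, computed as the derivative of `x ↦ s x` at `1` in the direction `ξ` (a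
tangent vector at `s 1 = s`). -/
def generator {ES : Type*} [NormedAddCommGroup ES] [NormedSpace ℝ ES]
    {B : Type*} [TopologicalSpace B] (IS : ModelWithCorners ℝ ES B)
    {S : Type*} [TopologicalSpace S] [ChartedSpace B S]
    (act : S → G → S) (ξ : E) (s : S) : TangentSpace IS s :=
  (show ES from mfderiv 𝓘(ℝ, E) IS (fun x : G => act s x) 1 ξ)

/-- A strongly Hamiltonian right action of the Lie group `G` on the symplectic manifold `(S, Ω)`,
with equivariant moment map `J`: the function `J_ξ` generates the flow `s ↦ s exp(tξ)` in the sense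
that `dJ_ξ = Ω(·, ξ_S)`, and `J(s x) = x⁻¹ J(s)`. -/
structure IsStronglyHamiltonian {ES : Type*} [NormedAddCommGroup ES] [NormedSpace ℝ ES]
    {B : Type*} [TopologicalSpace B] {IS : ModelWithCorners ℝ ES B}
    {S : Type*} [TopologicalSpace S] [ChartedSpace B S]
    (Ω : DiffForm IS S 2) (act : S → G → S) (J : S → E →L[ℝ] ℝ) : Prop where
  act_one : ∀ s, act s 1 = s
  act_mul : ∀ s x y, act s (x * y) = act (act s x) y
  smooth_act : ContMDiff (IS.prod 𝓘(ℝ, E)) IS ∞ (fun q : S × G => act q.1 q.2)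
  invariant : ∀ x s, (Ω (act s x)).compContinuousLinearMap
    (mfderiv IS IS (fun s' => act s' x) s) = Ω s
  smooth_J : ContMDiff IS 𝓘(ℝ, E →L[ℝ] ℝ) ∞ J
  moment : ∀ (s : S) (ξ : E) (v : TangentSpace IS s),
    (show E →L[ℝ] ℝ from mfderiv IS 𝓘(ℝ, E →L[ℝ] ℝ) J s v) ξ = Ω s ![v, generator IS act ξ s]
  equivariant : ∀ s x, J (act s x) = coAd x⁻¹ (J s)

end LieGroups

/-! ### Marsden-Weinstein reduction `S^O = J⁻¹(O) / G` -/

section OrbitReduction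

variable {E : Type*} [NormedAddCommGroup E] [NormedSpace ℝ E]
  {G : Type*} [Group G] [TopologicalSpace G] [ChartedSpace E G]
  {ES : Type*} [NormedAddCommGroup ES] [NormedSpace ℝ ES]
  {B : Type*} [TopologicalSpace B] {IS : ModelWithCorners ℝ ES B}
  {S : Type*} [TopologicalSpace S] [ChartedSpace B S]

/-- The set `J⁻¹(O) / G` of `G`-orbits in `J⁻¹(O)`, for a right action `act` of `G`. -/
def OrbitSpace (act : S → G → S) (J : S → E →L[ℝ] ℝ) (O : Set (E →L[ℝ] ℝ)) : Type _ :=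
  Quot (fun a b : {s : S // J s ∈ O} => ∃ x : G, b.1 = act a.1 x)

/-- The projection `J⁻¹(O) → J⁻¹(O) / G`. -/
def OrbitSpace.mk (act : S → G → S) (J : S → E →L[ℝ] ℝ) (O : Set (E →L[ℝ] ℝ))
    (a : {s : S // J s ∈ O}) : OrbitSpace act J O :=
  Quot.mk _ a

/-- The given manifold structure on `J⁻¹(O) / G` and the form `ΩQ` on it are those of the reduced
symplectic manifold. Here `J⁻¹(O)` is identified with the set of pairs `(s, θ)` in `S × O` with
`J(s) = θ`; the projection of the latter on the quotient has to be smooth, to have smooth local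
sections through every point (that is, to be a submersion), and to pull `ΩQ` back to the restriction
of `Ω + Ω_O`, with the orbit form `Ω_O(ad*_ξ θ, ad*_η θ) = -θ([ξ, η])`. Smooth maps into `J⁻¹(O)`
are tested on open sets of Euclidean spaces. -/
structure IsOrbitReduction (Ω : DiffForm IS S 2) (act : S → G → S) (J : S → E →L[ℝ] ℝ)
    (O : Set (E →L[ℝ] ℝ)) {n : ℕ} [TopologicalSpace (OrbitSpace act J O)]
    [ChartedSpace (EuclideanSpace ℝ (Fin n)) (OrbitSpace act J O)]
    (ΩQ : DiffForm (𝓡 n) (OrbitSpace act J O) 2) : Prop where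
  t2Space : T2Space (OrbitSpace act J O)
  secondCountable : SecondCountableTopology (OrbitSpace act J O)
  isManifold : IsManifold (𝓡 n) ∞ (OrbitSpace act J O)
  symplectic : IsSymplectic ΩQ
  smooth_mk : ∀ (k : ℕ) (U : Set (EuclideanSpace ℝ (Fin k))), IsOpen U →
    ∀ f : EuclideanSpace ℝ (Fin k) → {s : S // J s ∈ O},
    ContMDiffOn (𝓡 k) IS ∞ (fun u => (f u).1) U →
    IsSmoothIntoOrbit G (F := EuclideanSpace ℝ (Fin k)) O (fun u => J (f u).1) U →
    ContMDiffOn (𝓡 k) (𝓡 n) ∞ (fun u => OrbitSpace.mk act J O (f u)) U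
  sections : ∀ c : {s : S // J s ∈ O}, ∃ V : Set (OrbitSpace act J O), IsOpen V ∧
    OrbitSpace.mk act J O c ∈ V ∧ ∃ σ : OrbitSpace act J O → {s : S // J s ∈ O},
      ContMDiffOn (𝓡 n) IS ∞ (fun q => (σ q).1) V ∧
      IsSmoothIntoOrbit G (F := EuclideanSpace ℝ (Fin n)) O (fun q => J (σ q).1) V ∧
      σ (OrbitSpace.mk act J O c) = c ∧ ∀ q ∈ V, OrbitSpace.mk act J O (σ q) = q
  pullback : ∀ (k : ℕ) (U : Set (EuclideanSpace ℝ (Fin k))), IsOpen U →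
    ∀ f : EuclideanSpace ℝ (Fin k) → {s : S // J s ∈ O},
    ContMDiffOn (𝓡 k) IS ∞ (fun u => (f u).1) U →
    IsSmoothIntoOrbit G (F := EuclideanSpace ℝ (Fin k)) O (fun u => J (f u).1) U →
    ∀ u ∈ U, ∀ v w : EuclideanSpace ℝ (Fin k), ∀ ξ η : E,
    IsCoadVector G ξ (J (f u).1) (fderiv ℝ (fun u' => J (f u').1) u v) →
    IsCoadVector G η (J (f u).1) (fderiv ℝ (fun u' => J (f u').1) u w) →
    ΩQ (OrbitSpace.mk act J O (f u))
        ![mfderiv (𝓡 k) (𝓡 n) (fun u' => OrbitSpace.mk act J O (f u')) u v,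
          mfderiv (𝓡 k) (𝓡 n) (fun u' => OrbitSpace.mk act J O (f u')) u w] =
      Ω (f u).1 ![mfderiv (𝓡 k) IS (fun u' => (f u').1) u v,
          mfderiv (𝓡 k) IS (fun u' => (f u').1) u w]
        + -(J (f u).1) (lieBr G ξ η)

/-- The set `J⁻¹(O) / G` can be made into a reduced symplectic manifold. -/
def HasOrbitReduction (Ω : DiffForm IS S 2) (act : S → G → S) (J : S → E →L[ℝ] ℝ)
    (O : Set (E →L[ℝ] ℝ)) : Prop :=
  ∃ (n : ℕ) (_ : TopologicalSpace (OrbitSpace act J O))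
    (_ : ChartedSpace (EuclideanSpace ℝ (Fin n)) (OrbitSpace act J O))
    (ΩQ : DiffForm (𝓡 n) (OrbitSpace act J O) 2), IsOrbitReduction Ω act J O ΩQ

end OrbitReduction

/-! ### Symplectic induction `S^X = (S *_{𝔤*} X) / G` -/

section Induction

variable {E : Type*} [NormedAddCommGroup E] [NormedSpace ℝ E]
  {G : Type*} [Group G]
  {ES : Type*} [NormedAddCommGroup ES] [NormedSpace ℝ ES]
  {B : Type*} [TopologicalSpace B] {IS : ModelWithCorners ℝ ES B}
  {S : Type*}
  {EX : Type*} [NormedAddCommGroup EX] [NormedSpace ℝ EX]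
  {BX : Type*} [TopologicalSpace BX] {IX : ModelWithCorners ℝ EX BX}
  {X : Type*}

/-- The set `(S *_{𝔤*} X) / G`, where `S *_{𝔤*} X` consists of the pairs `(s, z)` in `S × X` with
`J(s) = ρ(z)`, and `x` in `G` acts by `(s, z) ↦ (s x, x⁻¹ z)`; `act` is a right action on `S` and
`actX` a left action on `X`. -/
def InducedSpace (act : S → G → S) (J : S → E →L[ℝ] ℝ) (actX : G → X → X) (ρ : X → E →L[ℝ] ℝ) :
    Type _ :=
  Quot (fun a b : {q : S × X // J q.1 = ρ q.2} =>
    ∃ x : G, b.1 = (act a.1.1 x, actX x⁻¹ a.1.2))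

/-- The projection `S *_{𝔤*} X → (S *_{𝔤*} X) / G`. -/
def InducedSpace.mk (act : S → G → S) (J : S → E →L[ℝ] ℝ) (actX : G → X → X) (ρ : X → E →L[ℝ] ℝ)
    (a : {q : S × X // J q.1 = ρ q.2}) : InducedSpace act J actX ρ :=
  Quot.mk _ a

variable [TopologicalSpace S] [ChartedSpace B S] [TopologicalSpace X] [ChartedSpace BX X]

/-- The given manifold structure on `(S *_{𝔤*} X) / G` and the form `ΩQ` on it are those of the
induced symplectic manifold: the projection is smooth, has smooth local sections through every
point, and pulls `ΩQ` back to the restriction of `Ω + ΩX`. -/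
structure IsInduction (Ω : DiffForm IS S 2) (act : S → G → S) (J : S → E →L[ℝ] ℝ)
    (ΩX : DiffForm IX X 2) (actX : G → X → X) (ρ : X → E →L[ℝ] ℝ)
    {n : ℕ} [TopologicalSpace (InducedSpace act J actX ρ)]
    [ChartedSpace (EuclideanSpace ℝ (Fin n)) (InducedSpace act J actX ρ)]
    (ΩQ : DiffForm (𝓡 n) (InducedSpace act J actX ρ) 2) : Prop where
  t2Space : T2Space (InducedSpace act J actX ρ)
  secondCountable : SecondCountableTopology (InducedSpace act J actX ρ)
  isManifold : IsManifold (𝓡 n) ∞ (InducedSpace act J actX ρ)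
  symplectic : IsSymplectic ΩQ
  smooth_mk : ∀ (k : ℕ) (U : Set (EuclideanSpace ℝ (Fin k))), IsOpen U →
    ∀ f : EuclideanSpace ℝ (Fin k) → {q : S × X // J q.1 = ρ q.2},
    ContMDiffOn (𝓡 k) IS ∞ (fun u => (f u).1.1) U →
    ContMDiffOn (𝓡 k) IX ∞ (fun u => (f u).1.2) U →
    ContMDiffOn (𝓡 k) (𝓡 n) ∞ (fun u => InducedSpace.mk act J actX ρ (f u)) U
  sections : ∀ c : {q : S × X // J q.1 = ρ q.2}, ∃ V : Set (InducedSpace act J actX ρ), IsOpen V ∧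
    InducedSpace.mk act J actX ρ c ∈ V ∧
    ∃ σ : InducedSpace act J actX ρ → {q : S × X // J q.1 = ρ q.2},
      ContMDiffOn (𝓡 n) IS ∞ (fun q => (σ q).1.1) V ∧
      ContMDiffOn (𝓡 n) IX ∞ (fun q => (σ q).1.2) V ∧
      σ (InducedSpace.mk act J actX ρ c) = c ∧ ∀ q ∈ V, InducedSpace.mk act J actX ρ (σ q) = q
  pullback : ∀ (k : ℕ) (U : Set (EuclideanSpace ℝ (Fin k))), IsOpen U →
    ∀ f : EuclideanSpace ℝ (Fin k) → {q : S × X // J q.1 = ρ q.2},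
    ContMDiffOn (𝓡 k) IS ∞ (fun u => (f u).1.1) U →
    ContMDiffOn (𝓡 k) IX ∞ (fun u => (f u).1.2) U →
    ∀ u ∈ U, ∀ v w : EuclideanSpace ℝ (Fin k),
    ΩQ (InducedSpace.mk act J actX ρ (f u))
        ![mfderiv (𝓡 k) (𝓡 n) (fun u' => InducedSpace.mk act J actX ρ (f u')) u v,
          mfderiv (𝓡 k) (𝓡 n) (fun u' => InducedSpace.mk act J actX ρ (f u')) u w] =
      Ω (f u).1.1 ![mfderiv (𝓡 k) IS (fun u' => (f u').1.1) u v,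
          mfderiv (𝓡 k) IS (fun u' => (f u').1.1) u w]
        + ΩX (f u).1.2 ![mfderiv (𝓡 k) IX (fun u' => (f u').1.2) u v,
          mfderiv (𝓡 k) IX (fun u' => (f u').1.2) u w]

/-- The set `(S *_{𝔤*} X) / G` can be made into an induced symplectic manifold. -/
def HasInduction (Ω : DiffForm IS S 2) (act : S → G → S) (J : S → E →L[ℝ] ℝ)
    (ΩX : DiffForm IX X 2) (actX : G → X → X) (ρ : X → E →L[ℝ] ℝ) : Prop :=
  ∃ (n : ℕ) (_ : TopologicalSpace (InducedSpace act J actX ρ))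
    (_ : ChartedSpace (EuclideanSpace ℝ (Fin n)) (InducedSpace act J actX ρ))
    (ΩQ : DiffForm (𝓡 n) (InducedSpace act J actX ρ) 2), IsInduction Ω act J ΩX actX ρ ΩQ

end Induction

/-! ### Closed subgroups and the cotangent bundle of a Lie group -/

section Cotangent

variable {E : Type*} [NormedAddCommGroup E] [NormedSpace ℝ E]
  {G : Type*} [Group G] [TopologicalSpace G] [ChartedSpace E G]
  {EH : Type*} [NormedAddCommGroup EH] [NormedSpace ℝ EH]

/-- `H` is a closed subgroup of `G` with its structure of a Lie subgroup: the inclusion is an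
immersion. -/
structure IsClosedLieSubgroup (H : Subgroup G) [ChartedSpace EH H] : Prop where
  isClosed : IsClosed (H : Set G)
  smooth_val : ContMDiff 𝓘(ℝ, EH) 𝓘(ℝ, E) ∞ (Subtype.val : H → G)
  injective_mfderiv : ∀ h : H,
    Function.Injective (mfderiv 𝓘(ℝ, EH) 𝓘(ℝ, E) (Subtype.val : H → G) h)

/-- The inclusion of the Lie algebra of `H` in that of `G`. -/
def lieIncl (H : Subgroup G) [ChartedSpace EH H] : EH →L[ℝ] E :=
  mfderiv 𝓘(ℝ, EH) 𝓘(ℝ, E) (Subtype.val : H → G) 1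

/-- The restriction of an element of `𝔤*` to the Lie algebra of `H`. -/
def restrictDual (H : Subgroup G) [ChartedSpace EH H] (p : E →L[ℝ] ℝ) : EH →L[ℝ] ℝ :=
  p.comp (lieIncl H)

variable (E G) in
/-- The cotangent bundle of `G` in the left trivialization, `T*G = G × 𝔤*`: the pair `(x, p)` stands
for the covector `v ↦ p(x⁻¹ v)` at `x`. -/
abbrev Cotangent : Type _ := G × (E →L[ℝ] ℝ)

variable (E G) in
/-- The Liouville 1-form `θ_L` of `T*G`: at the covector `z`, a tangent vector is projected to `G`
and then the covector is applied to it. -/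
def liouville : DiffForm (𝓘(ℝ, E).prod 𝓘(ℝ, E →L[ℝ] ℝ)) (Cotangent E G) 1 := fun z =>
  ContinuousAlternatingMap.ofSubsingleton ℝ _ ℝ (0 : Fin 1)
    ((z.2.comp (leftTriv z.1)).comp
      (mfderiv (𝓘(ℝ, E).prod 𝓘(ℝ, E →L[ℝ] ℝ)) 𝓘(ℝ, E) (Prod.fst : Cotangent E G → G) z))

variable (E G) in
/-- The symplectic form `dθ_L` of `T*G`. -/
def cotangentForm : DiffForm (𝓘(ℝ, E).prod 𝓘(ℝ, E →L[ℝ] ℝ)) (Cotangent E G) 2 :=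
  extD (liouville E G)

/-- The right action of `H` on `T*G` induced by right multiplication, `(x, p) h = (x h, h⁻¹ p)`. -/
def cotangentAct (H : Subgroup G) (z : Cotangent E G) (h : H) : Cotangent E G :=
  (z.1 * h, coAd (h : G)⁻¹ z.2)

/-- The moment map `J_R(x, p) = p|𝔥` of the right `H`-action on `T*G`. -/
def momentR (H : Subgroup G) [ChartedSpace EH H] (z : Cotangent E G) : EH →L[ℝ] ℝ :=
  restrictDual H z.2

/-- The moment map `J_L(x, p) = x p` of the left `G`-action `y (x, p) = (y x, p)` on `T*G`. -/
def momentL (z : Cotangent E G) : E →L[ℝ] ℝ := coAd z.1 z.2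

/-- The reduced space `(T*G)^O = J_R⁻¹(O) / H`. -/
abbrev ReducedCotangent (H : Subgroup G) [ChartedSpace EH H] (O : Set (EH →L[ℝ] ℝ)) : Type _ :=
  OrbitSpace (cotangentAct (E := E) H) (momentR H) O

/-- The class `[x, p]_H`. -/
def ReducedCotangent.mk (H : Subgroup G) [ChartedSpace EH H] (O : Set (EH →L[ℝ] ℝ))
    (x : G) (p : E →L[ℝ] ℝ) (hp : restrictDual H p ∈ O) : ReducedCotangent (E := E) H O :=
  OrbitSpace.mk (cotangentAct H) (momentR H) O ⟨(x, p), hp⟩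

/-- The left `G`-action `y [x, p]_H = [y x, p]_H` on `(T*G)^O`. -/
def ReducedCotangent.act (H : Subgroup G) [ChartedSpace EH H] (O : Set (EH →L[ℝ] ℝ)) (y : G) :
    ReducedCotangent (E := E) H O → ReducedCotangent (E := E) H O :=
  Quot.map (fun a => ⟨(y * a.1.1, a.1.2), a.2⟩) (by
    rintro a b ⟨h, hb⟩
    refine ⟨h, ?_⟩
    simp only [cotangentAct, Prod.ext_iff] at hb ⊢
    exact ⟨by rw [hb.1, mul_assoc], hb.2⟩)

theorem Ad_mul [LieGroup 𝓘(ℝ, E) ∞ G] (x y : G) : Ad (E := E) (x * y) = (Ad x).comp (Ad y) := by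
  have hd : ∀ z : G, ContMDiff 𝓘(ℝ, E) 𝓘(ℝ, E) ∞ (fun w : G => z * w * z⁻¹) := fun z =>
    (contMDiff_mul_right (a := z⁻¹)).comp (contMDiff_mul_left (a := z))
  have h1 : (fun w : G => x * y * w * (x * y)⁻¹) =
      (fun w : G => x * w * x⁻¹) ∘ (fun w : G => y * w * y⁻¹) := by
    funext w
    simp [mul_assoc]
  have h2 : y * 1 * y⁻¹ = (1 : G) := by simp
  have h3 := mfderiv_comp (I := 𝓘(ℝ, E)) (I' := 𝓘(ℝ, E)) (I'' := 𝓘(ℝ, E)) (1 : G)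
    ((hd x).mdifferentiable (by simp) (y * 1 * y⁻¹)) ((hd y).mdifferentiable (by simp) 1)
  rw [← h1] at h3
  unfold Ad
  refine h3.trans ?_
  congr 1
  rw [h2]

theorem momentL_cotangentAct [LieGroup 𝓘(ℝ, E) ∞ G] (H : Subgroup G) (z : Cotangent E G) (h : H) :
    momentL (cotangentAct H z h) = momentL z := by
  simp only [momentL, cotangentAct, coAd, inv_inv, mul_inv_rev, ContinuousLinearMap.comp_assoc]
  rw [← Ad_mul]
  simp

/-- The moment map `J_L^O([x, p]_H) = x p` of the left `G`-action on `(T*G)^O`. -/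
def ReducedCotangent.moment [LieGroup 𝓘(ℝ, E) ∞ G] (H : Subgroup G) [ChartedSpace EH H]
    (O : Set (EH →L[ℝ] ℝ)) : ReducedCotangent (E := E) H O → E →L[ℝ] ℝ :=
  Quot.lift (fun a => momentL a.1) (by
    rintro a b ⟨h, hb⟩
    show momentL a.1 = momentL b.1
    rw [hb, momentL_cotangentAct])

end Cotangent

end SymplecticInduction

end

/-! A point of the fibre product is a pair (s, [x,p]_H) with J(s) = xp. Equivariance gives J(sx) =
p, and the element x of G moves the pair to (sx, [1, J(sx)]_H). Hence every G-class has a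
representative of the form (t, [1, J(t)]_H) with J(t)|𝔥 in O, and two such representatives are
equivalent exactly when the two points t differ by an element of H. So [t]_H ↦ [t, [1, J(t)]_H]_G is
a bijection (`stageMap`, `bijective_stageMap`), and W is its inverse.

Both reduced structures are characterized by smooth families upstairs, so it is enough to pass
between families. A family t in J_H⁻¹(O) gives the family (t, [1, J(t)]_H). Conversely, a family (s,
z) in the fibre product is lifted locally, through a smooth section of J_R⁻¹(O) → (T*G)^O, to a
family (x, p) over z, and t = sx is then a smooth family in J_H⁻¹(O) (`exists_stageLift`).

The forms agree because of one identity, `IsStronglyHamiltonian.apply_deriv_act`: along t = sx, the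
pull-back of Ω by t is the pull-back of Ω by s plus the pull-back of dθ_L by (x, J(t)). Adding the
orbit form, and using that the form on (T*G)^O pulls back to dθ_L + ω_O, one gets that Ω + ω_O along
t equals the sum of the two forms along (s, z) (`formPullback_stageLift`). The identity rests on the
explicit formula `cotangentForm_apply` for dθ_L, a consequence of the Maurer-Cartan equation, and on
Ω(ξ_S, η_S) = J([ξ,η]), a consequence of equivariance and of the fact that the derivative of Ad at
the identity is the bracket.

For existence, a symplectic structure on one quotient is carried to the other by the bijection
(`exists_symplectic_transport`), and the characterization by families is then verified. When both
structures are given, the same two constructions show that W and its inverse are smooth and that W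
preserves the forms. -/

noncomputable section

namespace SymplecticInduction

open Set Filter Topology VectorField

/-! ### The Lie bracket, left-invariant fields and the derivative of Ad, in charts. -/

/-- The adjoint action near the identity, in a chart: if `m` is a local multiplication and `c` the
conjugation, then the derivative of `a ↦ D₂c(a, e) η` is the antisymmetrized mixed second derivative
of `m`. -/
theorem fderiv_conj_of_local_group {E : Type*} [NormedAddCommGroup E] [NormedSpace ℝ E]
    {m c : E × E → E} {e : E} (hm : ContDiffAt ℝ ∞ m (e, e)) (hc : ContDiffAt ℝ ∞ c (e, e))
    (hmc : ∀ᶠ q in 𝓝 (e, e), m q = m (c q, q.1)) (hce : ∀ᶠ a in 𝓝 e, c (a, e) = e)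
    (hec : ∀ᶠ a in 𝓝 e, c (e, a) = a) (hme : ∀ᶠ a in 𝓝 e, m (a, e) = a) (ξ η : E) :
    fderiv ℝ (fun a => fderiv ℝ c (a, e) (0, η)) e ξ =
      fderiv ℝ (fderiv ℝ m) (e, e) (ξ, 0) (0, η) - fderiv ℝ (fderiv ℝ m) (e, e) (η, 0) (0, ξ) := by
  have hm' : DifferentiableAt ℝ (fderiv ℝ m) (e, e) :=
    (hm.fderiv_right (m := 1) (by norm_cast)).differentiableAt (by simp)
  have hc' : DifferentiableAt ℝ (fderiv ℝ c) (e, e) :=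
    (hc.fderiv_right (m := 1) (by norm_cast)).differentiableAt (by simp)
  have hmd : ∀ᶠ q in 𝓝 (e, e), DifferentiableAt ℝ m q :=
    ((hm.of_le (m := 1) (by norm_cast)).eventually (by simp)).mono fun q hq => hq.differentiableAt (by simp)
  have hcd : ∀ᶠ q in 𝓝 (e, e), DifferentiableAt ℝ c q :=
    ((hc.of_le (m := 1) (by norm_cast)).eventually (by simp)).mono fun q hq => hq.differentiableAt (by simp)
  have hl : Tendsto (fun a : E => (a, e)) (𝓝 e) (𝓝 (e, e)) :=
    (Continuous.prodMk continuous_id continuous_const).tendsto' _ _ rfl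
  have hr : Tendsto (fun a : E => (e, a)) (𝓝 e) (𝓝 (e, e)) :=
    (Continuous.prodMk continuous_const continuous_id).tendsto' _ _ rfl
  -- The identity ab = (aba⁻¹)a, differentiated in b at b = e. Differentiating the result in a along
  -- ξ produces the claim.
  have key : ∀ᶠ a in 𝓝 e, fderiv ℝ m (a, e) (0, η) =
      fderiv ℝ m (e, a) (fderiv ℝ c (a, e) (0, η), 0) := by
    filter_upwards [hl.eventually hmd, hl.eventually hcd, hr.eventually hmd,
      hl.eventually hmc.eventually_nhds, hce] with a h1 h2 h3 h4 h5
    have h4' : m =ᶠ[𝓝 (a, e)] fun q => m (c q, q.1) := h4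
    rw [h4'.fderiv_eq]
    have h6 : HasFDerivAt (fun q : E × E => (c q, q.1))
        ((fderiv ℝ c (a, e)).prod (ContinuousLinearMap.fst ℝ E E)) (a, e) :=
      h2.hasFDerivAt.prodMk hasFDerivAt_fst
    have h7 : HasFDerivAt m (fderiv ℝ m (e, a)) (c (a, e), (a, e).1) := by
      rw [h5]; exact h3.hasFDerivAt
    have h8 := (h7.comp (a, e) h6).fderiv
    rw [show (fun q : E × E => m (c q, q.1)) = m ∘ fun q => (c q, q.1) from rfl, h8]
    rfl
  have hA : HasFDerivAt (fun a => fderiv ℝ c (a, e) (0, η))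
      (fderiv ℝ (fun a => fderiv ℝ c (a, e) (0, η)) e) e := by
    refine DifferentiableAt.hasFDerivAt ?_
    have : DifferentiableAt ℝ (fun a => fderiv ℝ c (a, e)) e :=
      hc'.comp (f := fun a : E => (a, e)) e (by fun_prop)
    fun_prop
  have hL : HasFDerivAt (fun a => fderiv ℝ m (a, e) (0, η))
      (((fderiv ℝ (fderiv ℝ m) (e, e)).comp
        ((ContinuousLinearMap.id ℝ E).prod 0)).flip (0, η)) e := by
    have h1 : HasFDerivAt (fun a : E => (a, e)) ((ContinuousLinearMap.id ℝ E).prod 0) e :=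
      (hasFDerivAt_id e).prodMk (hasFDerivAt_const e e)
    have h2 := HasFDerivAt.comp (g := fderiv ℝ m) (f := fun a : E => (a, e)) e hm'.hasFDerivAt h1
    have h3 := h2.clm_apply (hasFDerivAt_const (𝕜 := ℝ) ((0, η) : E × E) e)
    refine h3.congr_fderiv ?_
    ext v
    simp
  have hR1 : HasFDerivAt (fun a : E => (e, a)) ((0 : E →L[ℝ] E).prod (ContinuousLinearMap.id ℝ E)) e :=
    (hasFDerivAt_const e e).prodMk (hasFDerivAt_id e)
  have hR2 := HasFDerivAt.comp (g := fderiv ℝ m) (f := fun a : E => (e, a)) e hm'.hasFDerivAt hR1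
  have hR := hR2.clm_apply (hA.prodMk (hasFDerivAt_const (𝕜 := ℝ) (0 : E) e))
  have hE := congrArg (fun T : E →L[ℝ] E => T ξ) (hL.unique (hR.congr_of_eventuallyEq key))
  have hid1 : ∀ ζ : E, fderiv ℝ c (e, e) (0, ζ) = ζ := by
    intro ζ
    have h1 : HasFDerivAt (fun a : E => (e, a)) ((0 : E →L[ℝ] E).prod (ContinuousLinearMap.id ℝ E)) e :=
      (hasFDerivAt_const e e).prodMk (hasFDerivAt_id e)
    have h2 := HasFDerivAt.comp (g := c) (f := fun a : E => (e, a)) e hcd.self_of_nhds.hasFDerivAt h1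
    have h3 := h2.unique ((hasFDerivAt_id e).congr_of_eventuallyEq hec)
    simpa using congrArg (fun T : E →L[ℝ] E => T ζ) h3
  have hid2 : ∀ ζ : E, fderiv ℝ m (e, e) (ζ, 0) = ζ := by
    intro ζ
    have h1 : HasFDerivAt (fun a : E => (a, e)) ((ContinuousLinearMap.id ℝ E).prod 0) e :=
      (hasFDerivAt_id e).prodMk (hasFDerivAt_const e e)
    have h2 := HasFDerivAt.comp (g := m) (f := fun a : E => (a, e)) e hmd.self_of_nhds.hasFDerivAt h1
    have h3 := h2.unique ((hasFDerivAt_id e).congr_of_eventuallyEq hme)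
    simpa using congrArg (fun T : E →L[ℝ] E => T ζ) h3
  -- The right side contributes the second derivative in the order (0, ξ), (η, 0); symmetry puts it
  -- in the order of the statement.
  have hsymm := (hm.isSymmSndFDerivAt (by
    rw [minSmoothness_of_isRCLikeNormedField]; exact ENat.LEInfty.out)).eq (0, ξ) (η, 0)
  simp [hid1, hid2] at hE
  rw [hsymm] at hE
  rw [hE]
  abel

section

variable {E : Type*} [NormedAddCommGroup E] [NormedSpace ℝ E]
  {G : Type*} [Group G] [TopologicalSpace G] [ChartedSpace E G]

/-- The multiplication `G × G → G`, in the preferred charts at `x`, `1` and `x`. -/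
def mulChart (x : G) (q : E × E) : E :=
  extChartAt 𝓘(ℝ, E) x
    ((extChartAt 𝓘(ℝ, E) x).symm q.1 * (extChartAt 𝓘(ℝ, E) (1 : G)).symm q.2)

variable (G) in
/-- The conjugation `(x, y) ↦ x y x⁻¹`, in the preferred chart at `1`. -/
def conjChart (q : E × E) : E :=
  extChartAt 𝓘(ℝ, E) (1 : G)
    ((extChartAt 𝓘(ℝ, E) (1 : G)).symm q.1 * (extChartAt 𝓘(ℝ, E) (1 : G)).symm q.2 *
      ((extChartAt 𝓘(ℝ, E) (1 : G)).symm q.1)⁻¹)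

theorem _root_.HasMFDerivAt.hasFDerivAt_comp_extChartAt_symm {M : Type*} [TopologicalSpace M]
    [ChartedSpace E M] {F : Type*} [NormedAddCommGroup F] [NormedSpace ℝ F] {f : M → F} {x : M}
    {f' : E →L[ℝ] F} (h : HasMFDerivAt 𝓘(ℝ, E) 𝓘(ℝ, F) f x f') :
    HasFDerivAt (f ∘ (extChartAt 𝓘(ℝ, E) x).symm) f' (extChartAt 𝓘(ℝ, E) x x) := by
  have h2 := h.2
  rw [modelWithCornersSelf_coe, range_id] at h2
  exact hasFDerivWithinAt_univ.1 h2

theorem contMDiffAt_extChartAt_symm {M : Type*} [TopologicalSpace M] [ChartedSpace E M]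
    [IsManifold 𝓘(ℝ, E) ∞ M] (x : M) {a : E} (ha : a ∈ (extChartAt 𝓘(ℝ, E) x).target) :
    ContMDiffAt 𝓘(ℝ, E) 𝓘(ℝ, E) ∞ (extChartAt 𝓘(ℝ, E) x).symm a :=
  (contMDiffOn_extChartAt_symm x).contMDiffAt
    ((isOpen_extChartAt_target x).mem_nhds ha)

variable [LieGroup 𝓘(ℝ, E) ∞ G]

theorem contDiffAt_mulChart (x : G) :
    ContDiffAt ℝ ∞ (mulChart (E := E) x) (extChartAt 𝓘(ℝ, E) x x, extChartAt 𝓘(ℝ, E) (1 : G) 1) := by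
  rw [← contMDiffAt_iff_contDiffAt]
  have h1 : ContMDiffAt 𝓘(ℝ, E × E) 𝓘(ℝ, E) ∞
      (fun q : E × E => (extChartAt 𝓘(ℝ, E) x).symm q.1 * (extChartAt 𝓘(ℝ, E) (1 : G)).symm q.2)
      (extChartAt 𝓘(ℝ, E) x x, extChartAt 𝓘(ℝ, E) (1 : G) 1) := by
    refine ContMDiffAt.mul ?_ ?_
    · exact ContMDiffAt.comp _ (contMDiffAt_extChartAt_symm x (mem_extChartAt_target x))
        contDiffAt_fst.contMDiffAt
    · exact ContMDiffAt.comp _ (contMDiffAt_extChartAt_symm (1 : G) (mem_extChartAt_target 1))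
        contDiffAt_snd.contMDiffAt
  refine ContMDiffAt.comp _ ?_ h1
  have : (extChartAt 𝓘(ℝ, E) x).symm (extChartAt 𝓘(ℝ, E) x x) *
    (extChartAt 𝓘(ℝ, E) (1 : G)).symm (extChartAt 𝓘(ℝ, E) (1 : G) 1) = x := by simp
  rw [this]
  exact contMDiffAt_extChartAt

theorem contDiffAt_conjChart :
    ContDiffAt ℝ ∞ (conjChart (E := E) G)
      (extChartAt 𝓘(ℝ, E) (1 : G) 1, extChartAt 𝓘(ℝ, E) (1 : G) 1) := by
  rw [← contMDiffAt_iff_contDiffAt]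
  have h0 := contMDiffAt_extChartAt_symm (E := E) (1 : G) (mem_extChartAt_target 1)
  let e := extChartAt 𝓘(ℝ, E) (1 : G) 1
  have hl : ContMDiffAt 𝓘(ℝ, E × E) 𝓘(ℝ, E) ∞
      (fun q : E × E => (extChartAt 𝓘(ℝ, E) (1 : G)).symm q.1) (e, e) :=
    ContMDiffAt.comp (e, e) h0 contDiffAt_fst.contMDiffAt
  have hr : ContMDiffAt 𝓘(ℝ, E × E) 𝓘(ℝ, E) ∞
      (fun q : E × E => (extChartAt 𝓘(ℝ, E) (1 : G)).symm q.2) (e, e) :=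
    ContMDiffAt.comp (e, e) h0 contDiffAt_snd.contMDiffAt
  have h1 : ContMDiffAt 𝓘(ℝ, E × E) 𝓘(ℝ, E) ∞
      (fun q : E × E => (extChartAt 𝓘(ℝ, E) (1 : G)).symm q.1 *
        (extChartAt 𝓘(ℝ, E) (1 : G)).symm q.2 * ((extChartAt 𝓘(ℝ, E) (1 : G)).symm q.1)⁻¹)
      (extChartAt 𝓘(ℝ, E) (1 : G) 1, extChartAt 𝓘(ℝ, E) (1 : G) 1) :=
    ((hl.mul hr).mul hl.inv)
  refine ContMDiffAt.comp _ ?_ h1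
  have : (extChartAt 𝓘(ℝ, E) (1 : G)).symm (extChartAt 𝓘(ℝ, E) (1 : G) 1) *
      (extChartAt 𝓘(ℝ, E) (1 : G)).symm (extChartAt 𝓘(ℝ, E) (1 : G) 1) *
      ((extChartAt 𝓘(ℝ, E) (1 : G)).symm (extChartAt 𝓘(ℝ, E) (1 : G) 1))⁻¹ = 1 := by simp
  rw [this]
  exact contMDiffAt_extChartAt

theorem Ad_apply_eq_fderiv_conjChart (η : E) :
    ∀ᶠ a in 𝓝 (extChartAt 𝓘(ℝ, E) (1 : G) 1),
      (Ad ((extChartAt 𝓘(ℝ, E) (1 : G)).symm a) : E →L[ℝ] E) η =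
        fderiv ℝ (conjChart (E := E) G) (a, extChartAt 𝓘(ℝ, E) (1 : G) 1) (0, η) := by
  set e := extChartAt 𝓘(ℝ, E) (1 : G) 1 with he
  have hcd : ∀ᶠ q in 𝓝 (e, e), DifferentiableAt ℝ (conjChart (E := E) G) q :=
    ((contDiffAt_conjChart.of_le (m := 1) (by norm_cast)).eventually (by simp)).mono
      fun q hq => hq.differentiableAt (by simp)
  have hl : Tendsto (fun a : E => (a, e)) (𝓝 e) (𝓝 (e, e)) :=
    (Continuous.prodMk continuous_id continuous_const).tendsto' _ _ rfl
  filter_upwards [hl.eventually hcd] with a ha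
  have hd : ContMDiff 𝓘(ℝ, E) 𝓘(ℝ, E) ∞ (fun w : G => (extChartAt 𝓘(ℝ, E) (1 : G)).symm a * w *
      ((extChartAt 𝓘(ℝ, E) (1 : G)).symm a)⁻¹) :=
    (contMDiff_mul_right (a := ((extChartAt 𝓘(ℝ, E) (1 : G)).symm a)⁻¹)).comp
      (contMDiff_mul_left (a := (extChartAt 𝓘(ℝ, E) (1 : G)).symm a))
  have hAd : (Ad ((extChartAt 𝓘(ℝ, E) (1 : G)).symm a) : E →L[ℝ] E) =
      fderiv ℝ (fun b => conjChart (E := E) G (a, b)) e := by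
    unfold Ad
    rw [(hd.mdifferentiable (by simp) 1).mfderiv]
    simp only [writtenInExtChartAt, mul_one, mul_inv_cancel, modelWithCornersSelf_coe, range_id,
      fderivWithin_univ]
    rfl
  rw [hAd]
  have h1 : HasFDerivAt (fun b : E => (a, b)) ((0 : E →L[ℝ] E).prod (ContinuousLinearMap.id ℝ E)) e :=
    (hasFDerivAt_const a e).prodMk (hasFDerivAt_id e)
  have h2 := HasFDerivAt.comp (g := conjChart (E := E) G) (f := fun b : E => (a, b)) e
    ha.hasFDerivAt h1
  have h3 := h2.fderiv
  simp only [Function.comp_def] at h3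
  rw [h3]
  simp

/-- The left-invariant vector fields, in charts. -/
theorem mpullbackWithin_mulInvariantVectorField (x : G) (η : E) :
    ∀ᶠ a in 𝓝 (extChartAt 𝓘(ℝ, E) x x),
      (mpullbackWithin 𝓘(ℝ, E) 𝓘(ℝ, E) (extChartAt 𝓘(ℝ, E) x).symm
        (mulInvariantVectorField (I := 𝓘(ℝ, E)) (G := G) η) (range 𝓘(ℝ, E)) a : E) =
      fderiv ℝ (mulChart (E := E) x) (a, extChartAt 𝓘(ℝ, E) (1 : G) 1) (0, η) := by
  set e := extChartAt 𝓘(ℝ, E) (1 : G) 1 with he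
  have hcd : ∀ᶠ q in 𝓝 (extChartAt 𝓘(ℝ, E) x x, e), DifferentiableAt ℝ (mulChart (E := E) x) q :=
    (((contDiffAt_mulChart x).of_le (m := 1) (by norm_cast)).eventually (by simp)).mono
      fun q hq => hq.differentiableAt (by simp)
  have hl : Tendsto (fun a : E => (a, e)) (𝓝 (extChartAt 𝓘(ℝ, E) x x))
      (𝓝 (extChartAt 𝓘(ℝ, E) x x, e)) :=
    (Continuous.prodMk continuous_id continuous_const).tendsto' _ _ rfl
  have : IsManifold 𝓘(ℝ, E) 1 G := IsManifold.of_le (n := ∞) (by norm_cast)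
  filter_upwards [hl.eventually hcd, extChartAt_target_mem_nhds x] with a ha hat
  have h1 : HasFDerivAt (fun b : E => (a, b)) ((0 : E →L[ℝ] E).prod (ContinuousLinearMap.id ℝ E)) e :=
    (hasFDerivAt_const a e).prodMk (hasFDerivAt_id e)
  have h2 := HasFDerivAt.comp (g := mulChart (E := E) x) (f := fun b : E => (a, b)) e
    ha.hasFDerivAt h1
  have hφ : HasMFDerivAt 𝓘(ℝ, E) 𝓘(ℝ, E) (extChartAt 𝓘(ℝ, E) x) ((extChartAt 𝓘(ℝ, E) x).symm a * 1)
      (mfderiv 𝓘(ℝ, E) 𝓘(ℝ, E) (extChartAt 𝓘(ℝ, E) x) ((extChartAt 𝓘(ℝ, E) x).symm a) :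
        E →L[ℝ] E) := by
    rw [mul_one]
    refine MDifferentiableAt.hasMFDerivAt (mdifferentiableAt_extChartAt ?_)
    rw [← extChartAt_source 𝓘(ℝ, E)]
    exact (extChartAt 𝓘(ℝ, E) x).map_target hat
  have hg := HasMFDerivAt.comp (f := fun y : G => (extChartAt 𝓘(ℝ, E) x).symm a * y) _ hφ
    ((contMDiff_mul_left (n := ∞)).mdifferentiable (by simp) 1).hasMFDerivAt
  -- Two computations of the derivative at the identity of b ↦ yb read in charts: as a partial
  -- derivative of `mulChart`, and as left translation by y followed by the derivative of the chart.
  have h4 := h2.unique (hg.hasFDerivAt_comp_extChartAt_symm)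
  have h5 := congrArg (fun T : E →L[ℝ] E => T η) h4
  have h6 : (mfderivWithin 𝓘(ℝ, E) 𝓘(ℝ, E) (extChartAt 𝓘(ℝ, E) x).symm (range 𝓘(ℝ, E)) a).inverse =
      mfderiv 𝓘(ℝ, E) 𝓘(ℝ, E) (extChartAt 𝓘(ℝ, E) x) ((extChartAt 𝓘(ℝ, E) x).symm a) :=
    ContinuousLinearMap.inverse_eq (mfderivWithin_extChartAt_symm_comp_mfderiv_extChartAt hat)
      (mfderiv_extChartAt_comp_mfderivWithin_extChartAt_symm hat)
  rw [mpullbackWithin_apply, h6]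
  refine Eq.trans ?_ (h5.symm.trans ?_)
  · rfl
  · simp

theorem leftTriv_mulInvariantVectorField (x : G) (η : E) :
    leftTriv x (mulInvariantVectorField (I := 𝓘(ℝ, E)) (G := G) η x) = η := by
  have h1 : HasMFDerivAt 𝓘(ℝ, E) 𝓘(ℝ, E) (fun y : G => x⁻¹ * y) (x * 1) (leftTriv x) := by
    rw [mul_one]
    exact ((contMDiff_mul_left (n := ∞)).mdifferentiable (by simp) x).hasMFDerivAt
  have h2 : HasMFDerivAt 𝓘(ℝ, E) 𝓘(ℝ, E) (fun y : G => x * y) 1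
      (mfderiv 𝓘(ℝ, E) 𝓘(ℝ, E) (fun y : G => x * y) 1) :=
    ((contMDiff_mul_left (n := ∞)).mdifferentiable (by simp) 1).hasMFDerivAt
  have h3 := HasMFDerivAt.comp (1 : G) h1 h2
  have h4 : (fun y : G => x⁻¹ * y) ∘ (fun y : G => x * y) = id := by ext; simp
  rw [h4] at h3
  have h5 := hasMFDerivAt_unique h3 (hasMFDerivAt_id (1 : G))
  exact congrArg (fun T : E →L[ℝ] E => T η) h5

theorem mlieBracket_mulInvariantVectorField_eq (x : G) (ξ η : E) :
    (mlieBracket 𝓘(ℝ, E) (mulInvariantVectorField (I := 𝓘(ℝ, E)) (G := G) ξ)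
      (mulInvariantVectorField (I := 𝓘(ℝ, E)) (G := G) η) x : E) =
    lieBracket ℝ
      (fun a => fderiv ℝ (mulChart (E := E) x) (a, extChartAt 𝓘(ℝ, E) (1 : G) 1) (0, ξ))
      (fun a => fderiv ℝ (mulChart (E := E) x) (a, extChartAt 𝓘(ℝ, E) (1 : G) 1) (0, η))
      (extChartAt 𝓘(ℝ, E) x x) := by
  have : IsManifold 𝓘(ℝ, E) 1 G := IsManifold.of_le (n := ∞) (by norm_cast)
  rw [mlieBracket, mlieBracketWithin_apply, mfderiv_extChartAt_self]
  refine (congrArg (fun T : E →L[ℝ] E => T _) ContinuousLinearMap.inverse_id).trans ?_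
  have h1 := Filter.EventuallyEq.lieBracket_vectorField_eq (𝕜 := ℝ)
    (mpullbackWithin_mulInvariantVectorField x ξ) (mpullbackWithin_mulInvariantVectorField x η)
  refine Eq.trans ?_ h1
  simp only [preimage_univ, univ_inter]
  rw [modelWithCornersSelf_coe, range_id]
  exact congrFun lieBracketWithin_univ _

theorem differentiableAt_fderiv_mulChart (x : G) (η : E) :
    DifferentiableAt ℝ
      (fun a => fderiv ℝ (mulChart (E := E) x) (a, extChartAt 𝓘(ℝ, E) (1 : G) 1) (0, η))
      (extChartAt 𝓘(ℝ, E) x x) := by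
  have hm' : DifferentiableAt ℝ (fderiv ℝ (mulChart (E := E) x))
      (extChartAt 𝓘(ℝ, E) x x, extChartAt 𝓘(ℝ, E) (1 : G) 1) :=
    ((contDiffAt_mulChart x).fderiv_right (m := 1) (by norm_cast)).differentiableAt (by simp)
  have : DifferentiableAt ℝ
      (fun a => fderiv ℝ (mulChart (E := E) x) (a, extChartAt 𝓘(ℝ, E) (1 : G) 1))
      (extChartAt 𝓘(ℝ, E) x x) :=
    hm'.comp (f := fun a : E => (a, extChartAt 𝓘(ℝ, E) (1 : G) 1)) _ (by fun_prop)
  fun_prop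

/-- In the chart at 1 the left-invariant field of η is a ↦ D₂m(a, e)η, with value η at e. So the two
terms of the bracket of such fields at e are mixed second derivatives of the multiplication m. This
matches the formula that `fderiv_conj_of_local_group` gives for Ad. -/
theorem lieBr_eq_sndFDeriv (ξ η : E) :
    lieBr G ξ η = 
      fderiv ℝ (fderiv ℝ (mulChart (E := E) (1 : G)))
        (extChartAt 𝓘(ℝ, E) (1 : G) 1, extChartAt 𝓘(ℝ, E) (1 : G) 1) (ξ, 0) (0, η) -
      fderiv ℝ (fderiv ℝ (mulChart (E := E) (1 : G)))
        (extChartAt 𝓘(ℝ, E) (1 : G) 1, extChartAt 𝓘(ℝ, E) (1 : G) 1) (η, 0) (0, ξ) := by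
  refine (mlieBracket_mulInvariantVectorField_eq (1 : G) ξ η).trans ?_
  set e := extChartAt 𝓘(ℝ, E) (1 : G) 1
  have hm := contDiffAt_mulChart (E := E) (1 : G)
  have hm' : DifferentiableAt ℝ (fderiv ℝ (mulChart (E := E) (1 : G))) (e, e) :=
    (hm.fderiv_right (m := 1) (by norm_cast)).differentiableAt (by simp)
  have hL : ∀ ζ v : E, fderiv ℝ (fun a => fderiv ℝ (mulChart (E := E) (1 : G)) (a, e) (0, ζ)) e v =
      fderiv ℝ (fderiv ℝ (mulChart (E := E) (1 : G))) (e, e) (v, 0) (0, ζ) := by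
    intro ζ v
    have h1 : HasFDerivAt (fun a : E => (a, e)) ((ContinuousLinearMap.id ℝ E).prod 0) e :=
      (hasFDerivAt_id e).prodMk (hasFDerivAt_const e e)
    have h2 := HasFDerivAt.comp (g := fderiv ℝ (mulChart (E := E) (1 : G))) (f := fun a : E => (a, e))
      e hm'.hasFDerivAt h1
    have h3 := (h2.clm_apply (hasFDerivAt_const (𝕜 := ℝ) ((0, ζ) : E × E) e)).fderiv
    simp only [Function.comp_def] at h3
    rw [h3]
    simp
  have hid : ∀ ζ : E, fderiv ℝ (mulChart (E := E) (1 : G)) (e, e) (0, ζ) = ζ := by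
    intro ζ
    have h1 : HasFDerivAt (fun a : E => (e, a)) ((0 : E →L[ℝ] E).prod (ContinuousLinearMap.id ℝ E)) e :=
      (hasFDerivAt_const e e).prodMk (hasFDerivAt_id e)
    have h2 := HasFDerivAt.comp (g := mulChart (E := E) (1 : G)) (f := fun a : E => (e, a)) e
      (hm.differentiableAt (by simp)).hasFDerivAt h1
    have h4 : ∀ᶠ a in 𝓝 e, mulChart (E := E) (1 : G) (e, a) = a := by
      filter_upwards [extChartAt_target_mem_nhds (I := 𝓘(ℝ, E)) (1 : G)] with a ha
      simp only [mulChart, e, extChartAt_to_inv, one_mul]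
      exact (extChartAt 𝓘(ℝ, E) (1 : G)).right_inv ha
    have h3 := h2.unique ((hasFDerivAt_id e).congr_of_eventuallyEq h4)
    exact congrArg (fun T : E →L[ℝ] E => T ζ) h3
  rw [lieBracket]
  simp only [hL, hid]
  rfl

theorem tendsto_extChartAt_symm_self {M : Type*} [TopologicalSpace M] [ChartedSpace E M] (x : M) :
    Tendsto (extChartAt 𝓘(ℝ, E) x).symm (𝓝 (extChartAt 𝓘(ℝ, E) x x)) (𝓝 x) := by
  have := (continuousAt_extChartAt_symm (I := 𝓘(ℝ, E)) x).tendsto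
  rwa [extChartAt_to_inv] at this

/-- The derivative of the adjoint action at the identity is the Lie bracket. -/
theorem hasMFDerivAt_Ad_apply (η : E) :
    ∃ A : E →L[ℝ] E, HasMFDerivAt 𝓘(ℝ, E) 𝓘(ℝ, E) (fun x : G => (Ad x : E →L[ℝ] E) η) 1 A ∧
      ∀ ξ, A ξ = lieBr G ξ η := by
  set e := extChartAt 𝓘(ℝ, E) (1 : G) 1 with he
  have hm := contDiffAt_mulChart (E := E) (1 : G)
  have hc := contDiffAt_conjChart (E := E) (G := G)
  have ht := extChartAt_target_mem_nhds (I := 𝓘(ℝ, E)) (1 : G)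
  have hs : ∀ᶠ y in 𝓝 (1 : G), y ∈ (extChartAt 𝓘(ℝ, E) (1 : G)).source :=
    extChartAt_source_mem_nhds (1 : G)
  have hφ := tendsto_extChartAt_symm_self (E := E) (1 : G)
  have hφ1 : Tendsto (fun q : E × E => (extChartAt 𝓘(ℝ, E) (1 : G)).symm q.1) (𝓝 (e, e)) (𝓝 1) :=
    hφ.comp (continuous_fst.tendsto' _ _ rfl)
  have hφ2 : Tendsto (fun q : E × E => (extChartAt 𝓘(ℝ, E) (1 : G)).symm q.2) (𝓝 (e, e)) (𝓝 1) :=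
    hφ.comp (continuous_snd.tendsto' _ _ rfl)
  have : IsTopologicalGroup G := topologicalGroup_of_lieGroup 𝓘(ℝ, E) ∞
  -- Near (1, 1) conjugates stay in the domain of the chart, so that `conjChart` can be decoded and
  -- xy = (xyx⁻¹)x becomes an identity between chart expressions.
  have hcs : ∀ᶠ q in 𝓝 (e, e), (extChartAt 𝓘(ℝ, E) (1 : G)).symm q.1 *
      (extChartAt 𝓘(ℝ, E) (1 : G)).symm q.2 * ((extChartAt 𝓘(ℝ, E) (1 : G)).symm q.1)⁻¹ ∈
      (extChartAt 𝓘(ℝ, E) (1 : G)).source := by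
    have h := (hφ1.mul hφ2).mul hφ1.inv
    rw [mul_one, inv_one, mul_one] at h
    exact h.eventually hs
  have key := fun ξ => fderiv_conj_of_local_group (m := mulChart (E := E) (1 : G))
    (c := conjChart (E := E) G) (e := e) hm hc
    (by
      filter_upwards [hcs] with q hq
      simp only [mulChart, conjChart]
      rw [(extChartAt 𝓘(ℝ, E) (1 : G)).left_inv hq]
      simp)
    (by
      filter_upwards with a
      simp [conjChart, e])
    (by
      filter_upwards [ht] with a ha
      simp only [conjChart, e, extChartAt_to_inv, one_mul, inv_one, mul_one]
      exact (extChartAt 𝓘(ℝ, E) (1 : G)).right_inv ha)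
    (by
      filter_upwards [ht] with a ha
      simp only [mulChart, e, extChartAt_to_inv, mul_one]
      exact (extChartAt 𝓘(ℝ, E) (1 : G)).right_inv ha) ξ η
  have hd : DifferentiableAt ℝ (fun a => fderiv ℝ (conjChart (E := E) G) (a, e) (0, η)) e := by
    have hc' : DifferentiableAt ℝ (fderiv ℝ (conjChart (E := E) G)) (e, e) :=
      (hc.fderiv_right (m := 1) (by norm_cast)).differentiableAt (by simp)
    have : DifferentiableAt ℝ (fun a => fderiv ℝ (conjChart (E := E) G) (a, e)) e :=
      hc'.comp (f := fun a : E => (a, e)) e (by fun_prop)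
    fun_prop
  refine ⟨fderiv ℝ (fun a => fderiv ℝ (conjChart (E := E) G) (a, e) (0, η)) e, ?_, fun ξ => ?_⟩
  · have h1 : HasFDerivAt (fun a => (Ad ((extChartAt 𝓘(ℝ, E) (1 : G)).symm a) : E →L[ℝ] E) η) _ e :=
      hd.hasFDerivAt.congr_of_eventuallyEq (Ad_apply_eq_fderiv_conjChart η)
    have : IsManifold 𝓘(ℝ, E) 1 G := IsManifold.of_le (n := ∞) (by norm_cast)
    have hx := (mdifferentiableAt_extChartAt (I := 𝓘(ℝ, E)) (mem_chart_source E (1 : G))).hasMFDerivAt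
    rw [mfderiv_extChartAt_self] at hx
    have h2 := HasMFDerivAt.comp (1 : G) h1.hasMFDerivAt hx
    refine (h2.congr_of_eventuallyEq ?_)
    filter_upwards [hs] with y hy
    change _ = Ad ((extChartAt 𝓘(ℝ, E) (1 : G)).symm (extChartAt 𝓘(ℝ, E) (1 : G) y)) η
    rw [(extChartAt 𝓘(ℝ, E) (1 : G)).left_inv hy]
  · rw [key, lieBr_eq_sndFDeriv]

/-- Left translation takes the bracket of left-invariant fields to the bracket of the Lie algebra. -/
theorem leftTriv_mlieBracket [CompleteSpace E] (x : G) (ξ η : E) :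
    leftTriv x (mlieBracket 𝓘(ℝ, E) (mulInvariantVectorField (I := 𝓘(ℝ, E)) (G := G) ξ)
      (mulInvariantVectorField (I := 𝓘(ℝ, E)) (G := G) η) x) = lieBr G ξ η := by
  have : LieGroup 𝓘(ℝ, E) (minSmoothness ℝ 3) G := LieGroup.of_le (n := ∞) (by
    rw [minSmoothness_of_isRCLikeNormedField]; exact ENat.LEInfty.out)
  exact (congrArg (leftTriv x)
    (congrFun (mulInvariantVector_mlieBracket (I := 𝓘(ℝ, E)) (G := G) ξ η) x).symm).trans
    (leftTriv_mulInvariantVectorField x _)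

end

/-! ### The Maurer-Cartan equation and the explicit symplectic form of T*G. -/

section

variable {E : Type*} [NormedAddCommGroup E] [NormedSpace ℝ E]
  {G : Type*} [Group G] [TopologicalSpace G] [ChartedSpace E G]

theorem extD_apply {B : Type*} [TopologicalSpace B] {I : ModelWithCorners ℝ E B} {M : Type*}
    [TopologicalSpace M] [ChartedSpace B M] [IsManifold I 1 M] {k : ℕ} (Ω : DiffForm I M k) (x : M) :
    (extD Ω x : E [⋀^Fin (k + 1)]→L[ℝ] ℝ) = extDeriv (inChart Ω x) (extChartAt I x x) := by
  unfold extD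
  rw [mfderiv_extChartAt_self]
  rfl

/-- The left division `(x, y) ↦ x⁻¹ y`, in the preferred charts at `x` and `1`. -/
def divChart (x : G) (q : E × E) : E :=
  extChartAt 𝓘(ℝ, E) (1 : G)
    (((extChartAt 𝓘(ℝ, E) x).symm q.1)⁻¹ * (extChartAt 𝓘(ℝ, E) x).symm q.2)

variable [LieGroup 𝓘(ℝ, E) ∞ G]

theorem contDiffAt_divChart (x : G) :
    ContDiffAt ℝ ∞ (divChart (E := E) x) (extChartAt 𝓘(ℝ, E) x x, extChartAt 𝓘(ℝ, E) x x) := by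
  rw [← contMDiffAt_iff_contDiffAt]
  have h0 := contMDiffAt_extChartAt_symm (E := E) x (mem_extChartAt_target x)
  let e := extChartAt 𝓘(ℝ, E) x x
  have hl : ContMDiffAt 𝓘(ℝ, E × E) 𝓘(ℝ, E) ∞
      (fun q : E × E => (extChartAt 𝓘(ℝ, E) x).symm q.1) (e, e) :=
    ContMDiffAt.comp (e, e) h0 contDiffAt_fst.contMDiffAt
  have hr : ContMDiffAt 𝓘(ℝ, E × E) 𝓘(ℝ, E) ∞
      (fun q : E × E => (extChartAt 𝓘(ℝ, E) x).symm q.2) (e, e) :=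
    ContMDiffAt.comp (e, e) h0 contDiffAt_snd.contMDiffAt
  refine ContMDiffAt.comp _ ?_ (hl.inv.mul hr)
  have : ((extChartAt 𝓘(ℝ, E) x).symm (extChartAt 𝓘(ℝ, E) x x))⁻¹ *
    (extChartAt 𝓘(ℝ, E) x).symm (extChartAt 𝓘(ℝ, E) x x) = 1 := by simp
  simp only [this]
  exact contMDiffAt_extChartAt

theorem mfderiv_extChartAt_symm_self {M : Type*} [TopologicalSpace M] [ChartedSpace E M]
    [IsManifold 𝓘(ℝ, E) 1 M] (x : M) :
    (mfderiv 𝓘(ℝ, E) 𝓘(ℝ, E) (extChartAt 𝓘(ℝ, E) x).symm (extChartAt 𝓘(ℝ, E) x x) : E →L[ℝ] E) =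
      ContinuousLinearMap.id ℝ E := by
  have := mfderivWithin_range_extChartAt_symm (I := 𝓘(ℝ, E)) (x := x)
  rw [modelWithCornersSelf_coe, range_id, mfderivWithin_univ] at this
  exact this

/-- The Maurer-Cartan form, in a chart. -/
theorem leftTriv_eq_fderiv_divChart (x : G) :
    ∀ᶠ a in 𝓝 (extChartAt 𝓘(ℝ, E) x x), ∀ b : E,
      leftTriv ((extChartAt 𝓘(ℝ, E) x).symm a)
        (mfderiv 𝓘(ℝ, E) 𝓘(ℝ, E) (extChartAt 𝓘(ℝ, E) x).symm a b) =
      fderiv ℝ (divChart (E := E) x) (a, a) (0, b) := by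
  have hcd : ∀ᶠ q in 𝓝 (extChartAt 𝓘(ℝ, E) x x, extChartAt 𝓘(ℝ, E) x x),
      DifferentiableAt ℝ (divChart (E := E) x) q :=
    (((contDiffAt_divChart x).of_le (m := 1) (by norm_cast)).eventually (by simp)).mono
      fun q hq => hq.differentiableAt (by simp)
  have hl : Tendsto (fun a : E => (a, a)) (𝓝 (extChartAt 𝓘(ℝ, E) x x))
      (𝓝 (extChartAt 𝓘(ℝ, E) x x, extChartAt 𝓘(ℝ, E) x x)) :=
    (Continuous.prodMk continuous_id continuous_id).tendsto' _ _ rfl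
  have : IsManifold 𝓘(ℝ, E) 1 G := IsManifold.of_le (n := ∞) (by norm_cast)
  filter_upwards [hl.eventually hcd, extChartAt_target_mem_nhds x] with a ha hat b
  have h1 : HasFDerivAt (fun b : E => (a, b)) ((0 : E →L[ℝ] E).prod (ContinuousLinearMap.id ℝ E)) a :=
    (hasFDerivAt_const a a).prodMk (hasFDerivAt_id a)
  have h2 := HasFDerivAt.comp (g := divChart (E := E) x) (f := fun b : E => (a, b)) a
    ha.hasFDerivAt h1
  have hs : HasMFDerivAt 𝓘(ℝ, E) 𝓘(ℝ, E) (extChartAt 𝓘(ℝ, E) x).symm a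
      (mfderiv 𝓘(ℝ, E) 𝓘(ℝ, E) (extChartAt 𝓘(ℝ, E) x).symm a) :=
    ((contMDiffAt_extChartAt_symm x hat).mdifferentiableAt (by simp)).hasMFDerivAt
  have hmul : HasMFDerivAt 𝓘(ℝ, E) 𝓘(ℝ, E) (fun y : G => ((extChartAt 𝓘(ℝ, E) x).symm a)⁻¹ * y)
      ((extChartAt 𝓘(ℝ, E) x).symm a) (leftTriv ((extChartAt 𝓘(ℝ, E) x).symm a)) :=
    ((contMDiff_mul_left (n := ∞)).mdifferentiable (by simp) _).hasMFDerivAt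
  have hφ : HasMFDerivAt 𝓘(ℝ, E) 𝓘(ℝ, E) (extChartAt 𝓘(ℝ, E) (1 : G))
      (((extChartAt 𝓘(ℝ, E) x).symm a)⁻¹ * (extChartAt 𝓘(ℝ, E) x).symm a)
      (ContinuousLinearMap.id ℝ E) := by
    rw [inv_mul_cancel]
    have := (mdifferentiableAt_extChartAt (I := 𝓘(ℝ, E)) (mem_chart_source E (1 : G))).hasMFDerivAt
    rwa [mfderiv_extChartAt_self] at this
  have h3 := HasMFDerivAt.comp a (HasMFDerivAt.comp _ hφ hmul) hs
  have h4 := h2.unique (hasMFDerivAt_iff_hasFDerivAt.1 h3)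
  have h5 := congrArg (fun T : E →L[ℝ] E => T b) h4
  refine Eq.trans ?_ (h5.symm.trans ?_)
  · rfl
  · simp

theorem leftTriv_injective (x : G) : Function.Injective (leftTriv (E := E) x) := by
  have h1 : HasMFDerivAt 𝓘(ℝ, E) 𝓘(ℝ, E) (fun y : G => x⁻¹ * y) x (leftTriv x) :=
    ((contMDiff_mul_left (n := ∞)).mdifferentiable (by simp) x).hasMFDerivAt
  have h2 : HasMFDerivAt 𝓘(ℝ, E) 𝓘(ℝ, E) (fun y : G => x * y) (x⁻¹ * x)
      (mfderiv 𝓘(ℝ, E) 𝓘(ℝ, E) (fun y : G => x * y) (x⁻¹ * x)) :=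
    ((contMDiff_mul_left (n := ∞)).mdifferentiable (by simp) _).hasMFDerivAt
  have h3 := HasMFDerivAt.comp x h2 h1
  have h4 : (fun y : G => x * y) ∘ (fun y : G => x⁻¹ * y) = id := by ext; simp
  rw [h4] at h3
  have h5 := hasMFDerivAt_unique h3 (hasMFDerivAt_id x)
  intro v w hvw
  have hv : _ = v := congrArg (fun T : E →L[ℝ] E => T v) h5
  have hw : _ = w := congrArg (fun T : E →L[ℝ] E => T w) h5
  rw [← hv, ← hw]
  exact congrArg (mfderiv 𝓘(ℝ, E) 𝓘(ℝ, E) (fun y : G => x * y) (x⁻¹ * x)) hvw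

/-- The Maurer-Cartan equation, in a chart. -/
theorem fderiv_divChart_antisymm [CompleteSpace E] (x : G) :
    ∃ Λ : E → E →L[ℝ] E, DifferentiableAt ℝ Λ (extChartAt 𝓘(ℝ, E) x x) ∧
      (∀ᶠ a in 𝓝 (extChartAt 𝓘(ℝ, E) x x), ∀ b : E,
        leftTriv ((extChartAt 𝓘(ℝ, E) x).symm a)
          (mfderiv 𝓘(ℝ, E) 𝓘(ℝ, E) (extChartAt 𝓘(ℝ, E) x).symm a b) = Λ a b) ∧
      Λ (extChartAt 𝓘(ℝ, E) x x) = leftTriv x ∧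
      ∀ b b' : E, fderiv ℝ Λ (extChartAt 𝓘(ℝ, E) x x) b b' - fderiv ℝ Λ (extChartAt 𝓘(ℝ, E) x x) b' b =
        - lieBr G (leftTriv x b) (leftTriv x b') := by
  have : IsManifold 𝓘(ℝ, E) 1 G := IsManifold.of_le (n := ∞) (by norm_cast)
  let Λ : E → E →L[ℝ] E := fun a => (fderiv ℝ (divChart (E := E) x) (a, a)).comp
    ((0 : E →L[ℝ] E).prod (ContinuousLinearMap.id ℝ E))
  set e := extChartAt 𝓘(ℝ, E) x x with he
  have hΛd : DifferentiableAt ℝ Λ e := by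
    have hm' : DifferentiableAt ℝ (fderiv ℝ (divChart (E := E) x)) (e, e) :=
      ((contDiffAt_divChart x).fderiv_right (m := 1) (by norm_cast)).differentiableAt (by simp)
    have : DifferentiableAt ℝ (fun a => fderiv ℝ (divChart (E := E) x) (a, a)) e :=
      hm'.comp (f := fun a : E => (a, a)) _ (by fun_prop)
    exact this.clm_comp (by fun_prop)
  have hΛ : ∀ᶠ a in 𝓝 e, ∀ b : E,
        leftTriv ((extChartAt 𝓘(ℝ, E) x).symm a)
          (mfderiv 𝓘(ℝ, E) 𝓘(ℝ, E) (extChartAt 𝓘(ℝ, E) x).symm a b) = Λ a b := by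
    filter_upwards [leftTriv_eq_fderiv_divChart (E := E) x] with a ha b
    rw [ha b]
    simp [Λ]
  have hΛe : Λ e = leftTriv x := by
    ext b
    rw [← hΛ.self_of_nhds b]
    have h1 : mfderiv 𝓘(ℝ, E) 𝓘(ℝ, E) (extChartAt 𝓘(ℝ, E) x).symm e b = b :=
      congrArg (fun T : E →L[ℝ] E => T b) (mfderiv_extChartAt_symm_self x)
    refine (congrArg (leftTriv ((extChartAt 𝓘(ℝ, E) x).symm e)) h1).trans ?_
    rw [he, extChartAt_to_inv]
    rfl
  refine ⟨Λ, hΛd, hΛ, hΛe, fun b b' => ?_⟩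
  -- The left-invariant fields in the chart. The Maurer-Cartan form Λ is constant on each of them,
  -- which replaces a direct computation of its second-order terms.
  let X : E → E → E := fun η a =>
    fderiv ℝ (mulChart (E := E) x) (a, extChartAt 𝓘(ℝ, E) (1 : G) 1) (0, η)
  have hXd : ∀ η, DifferentiableAt ℝ (X η) e := fun η => differentiableAt_fderiv_mulChart x η
  have hΛX : ∀ η, ∀ᶠ a in 𝓝 e, Λ a (X η a) = η := by
    intro η
    filter_upwards [hΛ, mpullbackWithin_mulInvariantVectorField x η, extChartAt_target_mem_nhds x]
      with a h1 h2 h3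
    rw [← h1]
    have h4 : mfderiv 𝓘(ℝ, E) 𝓘(ℝ, E) (extChartAt 𝓘(ℝ, E) x).symm a (X η a) =
        mulInvariantVectorField (I := 𝓘(ℝ, E)) (G := G) η ((extChartAt 𝓘(ℝ, E) x).symm a) := by
      have h5 := (isInvertible_mfderivWithin_extChartAt_symm (I := 𝓘(ℝ, E)) h3)
      rw [← show _ = X η a from h2, mpullbackWithin_apply]
      rw [modelWithCornersSelf_coe, range_id, mfderivWithin_univ] at h5 ⊢
      exact h5.self_apply_inverse _
    exact (congrArg _ h4).trans (leftTriv_mulInvariantVectorField _ η)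
  have hX : ∀ b : E, X (leftTriv x b) e = b := by
    intro b
    apply leftTriv_injective x
    have := (hΛX (leftTriv x b)).self_of_nhds
    rwa [hΛe] at this
  -- Product rule applied to the constant function Λ(X η) = η. Antisymmetrizing, the right side
  -- becomes minus Λ of the bracket of two left-invariant fields.
  have hD : ∀ η w : E, fderiv ℝ Λ e w (X η e) = - Λ e (fderiv ℝ (X η) e w) := by
    intro η w
    have h1 := hΛd.hasFDerivAt.clm_apply (hXd η).hasFDerivAt
    have h2 := h1.unique ((hasFDerivAt_const (𝕜 := ℝ) η e).congr_of_eventuallyEq (hΛX η))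
    exact eq_neg_of_add_eq_zero_right (congrArg (fun T : E →L[ℝ] E => T w) h2)
  have hbr : lieBr G (leftTriv x b) (leftTriv x b') =
      Λ e (lieBracket ℝ (X (leftTriv x b)) (X (leftTriv x b')) e) := by
    rw [← leftTriv_mlieBracket x, hΛe]
    exact congrArg (leftTriv x) (mlieBracket_mulInvariantVectorField_eq x _ _)
  have h1 := hD (leftTriv x b') b
  have h2 := hD (leftTriv x b) b'
  rw [hX] at h1 h2
  have h3 : lieBracket ℝ (X (leftTriv x b)) (X (leftTriv x b')) e =
      fderiv ℝ (X (leftTriv x b')) e b - fderiv ℝ (X (leftTriv x b)) e b' := by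
    have h4 := congrFun (lieBracket_eq (𝕜 := ℝ) (V := X (leftTriv x b)) (W := X (leftTriv x b'))) e
    simp only [hX] at h4
    exact h4
  rw [hbr, h3, h1, h2, map_sub]
  abel

theorem extDeriv_ofSubsingleton {V : Type*} [NormedAddCommGroup V] [NormedSpace ℝ V]
    {α : V → V →L[ℝ] ℝ} {x : V} (hα : DifferentiableAt ℝ α x) (v w : V) :
    extDeriv (fun y => ContinuousAlternatingMap.ofSubsingleton ℝ V ℝ (0 : Fin 1) (α y)) x ![v, w] =
      fderiv ℝ α x v w - fderiv ℝ α x w v := by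
  have h1 : DifferentiableAt ℝ
      (fun y => ContinuousAlternatingMap.ofSubsingleton ℝ V ℝ (0 : Fin 1) (α y)) x :=
    (ContinuousAlternatingMap.ofSubsingletonLIE (𝕜 := ℝ) (E := V) (F := ℝ)
      (0 : Fin 1)).toContinuousLinearEquiv.differentiableAt.comp x hα
  have h2 : ∀ a b : V, fderiv ℝ (fun y => α y a) x b = fderiv ℝ α x b a := fun a b => by
    rw [fderiv_clm_apply hα (by fun_prop)]
    simp
  rw [extDeriv_apply h1, Fin.sum_univ_two, ← h2, ← h2]
  simp [Fin.removeNth, sub_eq_add_neg]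

/-- The symplectic form of the cotangent bundle, in the left trivialization. -/
theorem cotangentForm_apply [CompleteSpace E] (z : Cotangent E G) (b b' : E) (q q' : E →L[ℝ] ℝ) :
    (cotangentForm E G z : (E × (E →L[ℝ] ℝ)) [⋀^Fin 2]→L[ℝ] ℝ) ![(b, q), (b', q')] =
      q (leftTriv z.1 b') - q' (leftTriv z.1 b) -
        z.2 (lieBr G (leftTriv z.1 b) (leftTriv z.1 b')) := by
  have : IsManifold 𝓘(ℝ, E) 1 G := IsManifold.of_le (n := ∞) (by norm_cast)
  obtain ⟨Λ, hΛd, hΛ, hΛe, hΛa⟩ := fderiv_divChart_antisymm (E := E) z.1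
  let I := 𝓘(ℝ, E).prod 𝓘(ℝ, E →L[ℝ] ℝ)
  set e := extChartAt 𝓘(ℝ, E) z.1 z.1 with he
  have h1 : ∀ᶠ y in 𝓝 (extChartAt I z z), inChart (liouville E G) z y =
      ContinuousAlternatingMap.ofSubsingleton ℝ (E × (E →L[ℝ] ℝ)) ℝ (0 : Fin 1)
        ((y.2.comp (Λ y.1)).comp (ContinuousLinearMap.fst ℝ E (E →L[ℝ] ℝ))) := by
    have hf : Tendsto (Prod.fst : E × (E →L[ℝ] ℝ) → E) (𝓝 (extChartAt I z z)) (𝓝 e) :=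
      continuous_fst.tendsto' _ _ rfl
    filter_upwards [hf.eventually hΛ, hf.eventually (extChartAt_target_mem_nhds z.1)] with y hy hyt
    have hs : HasMFDerivAt 𝓘(ℝ, E) 𝓘(ℝ, E) (extChartAt 𝓘(ℝ, E) z.1).symm y.1
        (mfderiv 𝓘(ℝ, E) 𝓘(ℝ, E) (extChartAt 𝓘(ℝ, E) z.1).symm y.1) :=
      ((contMDiffAt_extChartAt_symm z.1 hyt).mdifferentiableAt (by simp)).hasMFDerivAt
    have hs' := HasMFDerivAt.comp y hs
      (hasFDerivAt_fst (𝕜 := ℝ) (p := y)).hasMFDerivAt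
    have hyt' : y ∈ (extChartAt I z).target := by
      rw [extChartAt_prod, PartialEquiv.prod_target]
      exact ⟨hyt, by rw [extChartAt_model_space_eq_id]; trivial⟩
    have hZ : HasMFDerivAt 𝓘(ℝ, E × (E →L[ℝ] ℝ)) I (extChartAt I z).symm y
        (mfderiv 𝓘(ℝ, E × (E →L[ℝ] ℝ)) I (extChartAt I z).symm y) := by
      have h := mdifferentiableWithinAt_extChartAt_symm hyt'
      rw [show range I = univ by simp [I],
        mdifferentiableWithinAt_univ] at h
      exact h.hasMFDerivAt
    have hF := HasMFDerivAt.comp y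
      (mdifferentiable_fst (I := 𝓘(ℝ, E)) (I' := 𝓘(ℝ, E →L[ℝ] ℝ))
        ((extChartAt I z).symm y)).hasMFDerivAt hZ
    -- The projection T*G → G read in the product chart is the first projection; hence θ_L at (a, p)
    -- is p ∘ Λ(a) ∘ fst in the chart.
    have hE := hasMFDerivAt_unique hF hs'
    ext v
    have hv := congrArg (fun T : (E × (E →L[ℝ] ℝ)) →L[ℝ] E => T (v 0)) hE
    have h2 := hy (v 0).1
    refine Eq.trans ?_ (congrArg y.2 h2)
    exact congrArg (fun w => y.2 (leftTriv ((extChartAt 𝓘(ℝ, E) z.1).symm y.1) w)) hv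
  unfold cotangentForm
  rw [extD_apply, Filter.EventuallyEq.extDeriv_eq h1]
  have hα : HasFDerivAt (fun y : E × (E →L[ℝ] ℝ) =>
      (y.2.comp (Λ y.1)).comp (ContinuousLinearMap.fst ℝ E (E →L[ℝ] ℝ))) _ (e, z.2) :=
    ((hasFDerivAt_snd (𝕜 := ℝ) (p := (e, z.2))).clm_comp
      (HasFDerivAt.comp (g := Λ) (f := Prod.fst) (e, z.2) hΛd.hasFDerivAt
        (hasFDerivAt_fst (𝕜 := ℝ) (p := (e, z.2))))).clm_comp
      (hasFDerivAt_const (ContinuousLinearMap.fst ℝ E (E →L[ℝ] ℝ)) (e, z.2))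
  refine (extDeriv_ofSubsingleton hα.differentiableAt (b, q) (b', q')).trans ?_
  rw [hα.fderiv]
  -- The terms of dθ_L in which Λ is differentiated form an antisymmetrization, evaluated by the
  -- Maurer-Cartan equation.
  have h3 := congrArg z.2 (hΛa b b')
  rw [map_sub, map_neg] at h3
  simp
  rw [hΛe]
  linear_combination h3

end

/-! ### Coadjoint velocities and the symplectic form along a moving group action. -/

section

variable {E : Type*} [NormedAddCommGroup E] [NormedSpace ℝ E]
  {G : Type*} [Group G] [TopologicalSpace G] [ChartedSpace E G]

theorem Ad_one : (Ad (1 : G) : E →L[ℝ] E) = ContinuousLinearMap.id ℝ E := by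
  have h : (fun y : G => 1 * y * 1⁻¹) = id := by ext; simp
  unfold Ad
  rw [h]
  exact mfderiv_id

theorem coAd_one (p : E →L[ℝ] ℝ) : coAd (1 : G) p = p := by
  rw [coAd, inv_one, Ad_one, ContinuousLinearMap.comp_id]

theorem coAd_mul [LieGroup 𝓘(ℝ, E) ∞ G] (x y : G) (p : E →L[ℝ] ℝ) : coAd (x * y) p = coAd x (coAd y p) := by
  rw [coAd, mul_inv_rev, Ad_mul]
  rfl

/-- The velocity of a smooth curve in a coadjoint orbit is of the form `ad*_ξ θ`. -/
theorem IsSmoothIntoOrbit.exists_isCoadVector [LieGroup 𝓘(ℝ, E) ∞ G] {F : Type*} [NormedAddCommGroup F] [NormedSpace ℝ F]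
    {O : Set (E →L[ℝ] ℝ)} {θ : F → E →L[ℝ] ℝ} {U : Set F} (h : IsSmoothIntoOrbit G (F := F) O θ U) {u : F}
    (hu : u ∈ U) (hθ : DifferentiableAt ℝ θ u) (v : F) :
    ∃ ξ : E, IsCoadVector G ξ (θ u) (fderiv ℝ θ u v) := by
  obtain ⟨V, hV, huV, μ, -, x, hx, hθx⟩ := h u hu
  -- With y(u') = x(u) x(u')⁻¹ one has θ(u') = θ(u) ∘ Ad(y(u')) and y(u) = 1, so only the derivative
  -- of Ad at the identity is needed.
  have hy : ContMDiffAt 𝓘(ℝ, F) 𝓘(ℝ, E) ∞ (fun u' => x u * (x u')⁻¹) u :=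
    contMDiffAt_const.mul (hx.contMDiffAt (hV.mem_nhds huV)).inv
  obtain ⟨D, hyd⟩ : ∃ D : F →L[ℝ] E,
      HasMFDerivAt 𝓘(ℝ, F) 𝓘(ℝ, E) (fun u' => x u * (x u')⁻¹) u D :=
    ⟨_, (hy.mdifferentiableAt (by simp)).hasMFDerivAt⟩
  -- The derivative of θ(u) ∘ Ad(y) at ζ is θ(u)([Dv, ζ]); the sign compensates the minus in
  -- `IsCoadVector`.
  refine ⟨-(D v), fun ζ => ?_⟩
  obtain ⟨A, hA, hAbr⟩ := hasMFDerivAt_Ad_apply (G := G) ζ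
  rw [← hAbr, map_neg, hAbr, map_neg, neg_neg, ← hAbr]
  have hA' : HasMFDerivAt 𝓘(ℝ, E) 𝓘(ℝ, E) (fun y : G => (Ad y : E →L[ℝ] E) ζ) (x u * (x u)⁻¹) A := by
    rw [mul_inv_cancel]; exact hA
  have h1 := HasMFDerivAt.comp u hA' hyd
  have h2 := HasFDerivAt.comp (g := θ u) u (θ u).hasFDerivAt (hasMFDerivAt_iff_hasFDerivAt.1 h1)
  have h3 : (fun u' => θ u' ζ) =ᶠ[𝓝 u]
      θ u ∘ (fun y : G => (Ad y : E →L[ℝ] E) ζ) ∘ fun u' => x u * (x u')⁻¹ := by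
    filter_upwards [hV.mem_nhds huV] with u' hu'
    rw [hθx u' hu', hθx u huV]
    simp only [coAd, Function.comp, ContinuousLinearMap.comp_apply]
    rw [← ContinuousLinearMap.comp_apply (Ad (x u)⁻¹), ← Ad_mul]
    simp
  have h4 := h2.congr_of_eventuallyEq h3
  have h5 : HasFDerivAt (fun u' => θ u' ζ) _ u :=
    hθ.hasFDerivAt.clm_apply (hasFDerivAt_const (𝕜 := ℝ) ζ u)
  have h6 := congrArg (fun T : F →L[ℝ] ℝ => T v) (h5.unique h4)
  refine Eq.trans ?_ (h6.trans rfl)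
  simp

/-- The expansion is arranged so that the last three terms match those of `cotangentForm_apply` when
g and h are tangent to a group orbit: the moment map condition evaluates the terms pairing a full
velocity with g or h, and the bracket formula evaluates the term in g and h alone. -/
theorem alternating_two_add {V : Type*} [AddCommGroup V] [Module ℝ V] [TopologicalSpace V]
    (α : V [⋀^Fin 2]→L[ℝ] ℝ) (a b g h : V) :
    α ![a + g, b + h] = α ![a, b] + α ![a + g, h] - α ![b + h, g] - α ![g, h] := by
  have hadd : ∀ a b c : V, α ![a + b, c] = α ![a, c] + α ![b, c] := fun a b c => by
    exact α.map_vecCons_add ![c] a b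
  have hswap : ∀ a b : V, α ![a, b] = - α ![b, a] := fun a b => by
    have := α.toAlternatingMap.map_swap ![b, a] (i := 0) (j := 1) (by simp)
    have h2 : ![b, a] ∘ Equiv.swap (0 : Fin 2) 1 = ![a, b] := by
      ext i; fin_cases i <;> simp
    rw [h2] at this
    exact this
  have hadd' : ∀ a b c : V, α ![c, a + b] = α ![c, a] + α ![c, b] := fun a b c => by
    rw [hswap c (a + b), hadd, hswap c a, hswap c b]; ring
  simp only [hadd, hadd']
  rw [hswap b g, hswap h g]
  ring

variable {ES : Type*} [NormedAddCommGroup ES] [NormedSpace ℝ ES]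
  {S : Type*} [TopologicalSpace S] [ChartedSpace ES S] 
  {Ω : DiffForm 𝓘(ℝ, ES) S 2} {act : S → G → S} {J : S → E →L[ℝ] ℝ}

theorem IsStronglyHamiltonian.contMDiff_act_left (hS : IsStronglyHamiltonian Ω act J) (x : G) :
    ContMDiff 𝓘(ℝ, ES) 𝓘(ℝ, ES) ∞ (fun s => act s x) :=
  hS.smooth_act.comp (contMDiff_id.prodMk contMDiff_const)

theorem IsStronglyHamiltonian.contMDiff_act_right (hS : IsStronglyHamiltonian Ω act J) (s : S) :
    ContMDiff 𝓘(ℝ, E) 𝓘(ℝ, ES) ∞ (fun x => act s x) :=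
  hS.smooth_act.comp (contMDiff_const.prodMk contMDiff_id)

variable [LieGroup 𝓘(ℝ, E) ∞ G]

/-- The value of the form on the vectors tangent to an orbit. -/
theorem IsStronglyHamiltonian.apply_generator_generator (hS : IsStronglyHamiltonian Ω act J) (s : S)
    (ξ η : E) :
    Ω s ![generator 𝓘(ℝ, ES) act ξ s, generator 𝓘(ℝ, ES) act η s] = J s (lieBr G ξ η) := by
  rw [← hS.moment]
  obtain ⟨A, hA, hAbr⟩ := hasMFDerivAt_Ad_apply (G := G) η
  have h1 : HasMFDerivAt 𝓘(ℝ, E) 𝓘(ℝ, ES) (fun x : G => act s x) 1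
      (mfderiv 𝓘(ℝ, E) 𝓘(ℝ, ES) (fun x : G => act s x) 1) :=
    ((hS.contMDiff_act_right s).mdifferentiable (by simp) 1).hasMFDerivAt
  have h2 : HasMFDerivAt 𝓘(ℝ, ES) 𝓘(ℝ, E →L[ℝ] ℝ) J (act s 1)
      (mfderiv 𝓘(ℝ, ES) 𝓘(ℝ, E →L[ℝ] ℝ) J s : ES →L[ℝ] (E →L[ℝ] ℝ)) := by
    rw [hS.act_one]
    exact (hS.smooth_J.mdifferentiable (by simp) s).hasMFDerivAt
  have h3 := HasMFDerivAt.comp _ h2 h1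
  have h4 : HasMFDerivAt 𝓘(ℝ, E →L[ℝ] ℝ) 𝓘(ℝ, ℝ) (fun p : E →L[ℝ] ℝ => p η) (J (act s 1))
      (ContinuousLinearMap.apply ℝ ℝ η) :=
    (ContinuousLinearMap.apply ℝ ℝ η).hasFDerivAt.hasMFDerivAt
  have h5 := HasMFDerivAt.comp (1 : G) h4 h3
  have h6 := HasMFDerivAt.comp (1 : G) (J s).hasFDerivAt.hasMFDerivAt hA
  -- Equivariance: J_η(sx) = J(s)(Ad(x)η), so the derivative of J_η along ξ_S is J(s) applied to the
  -- derivative of Ad.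
  have h7 : (fun p : E →L[ℝ] ℝ => p η) ∘ J ∘ (fun x : G => act s x) =
      J s ∘ fun x : G => (Ad x : E →L[ℝ] E) η := by
    ext x
    simp only [Function.comp, hS.equivariant, coAd, inv_inv, ContinuousLinearMap.comp_apply]
  rw [h7] at h5
  have h8 := congrArg (fun T : E →L[ℝ] ℝ => T ξ) (hasMFDerivAt_unique h5 h6)
  refine Eq.trans ?_ (h8.trans ?_)
  · rfl
  · exact congrArg (J s) (hAbr ξ)

/-- Chain rule for sy = (sx)(x⁻¹y): a variation of the group element at x is a variation at 1 acting
on the point sx. -/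
theorem IsStronglyHamiltonian.mfderiv_act_right (hS : IsStronglyHamiltonian Ω act J) (s : S) (x : G)
    (b : E) :
    (mfderiv 𝓘(ℝ, E) 𝓘(ℝ, ES) (fun y => act s y) x b : ES) =
      generator 𝓘(ℝ, ES) act (leftTriv x b) (act s x) := by
  have h1 : HasMFDerivAt 𝓘(ℝ, E) 𝓘(ℝ, ES) (fun y : G => act (act s x) y) (x⁻¹ * x)
      (mfderiv 𝓘(ℝ, E) 𝓘(ℝ, ES) (fun y : G => act (act s x) y) 1 : E →L[ℝ] ES) := by
    rw [inv_mul_cancel]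
    exact ((hS.contMDiff_act_right _).mdifferentiable (by simp) 1).hasMFDerivAt
  have h2 : HasMFDerivAt 𝓘(ℝ, E) 𝓘(ℝ, E) (fun y : G => x⁻¹ * y) x (leftTriv x) :=
    ((contMDiff_mul_left (n := ∞)).mdifferentiable (by simp) x).hasMFDerivAt
  have h3 := (HasMFDerivAt.comp x h1 h2).mfderiv
  have h4 : (fun y : G => act (act s x) y) ∘ (fun y : G => x⁻¹ * y) = fun y => act s y := by
    ext y
    simp [Function.comp, ← hS.act_mul]
  rw [h4] at h3
  exact congrArg (fun T : E →L[ℝ] ES => T b) h3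

/-- The form on `S` along a product `f · x`, where `f` is a map to `S` and `x` a map to `G`. -/
theorem IsStronglyHamiltonian.apply_deriv_act [CompleteSpace E]
    (hS : IsStronglyHamiltonian Ω act J) {F : Type*}
    [NormedAddCommGroup F] [NormedSpace ℝ F] {f : F → S} {x : F → G} {u : F}
    {f' g' : F →L[ℝ] ES} {x' : F →L[ℝ] E} {p' : F →L[ℝ] (E →L[ℝ] ℝ)}
    (hf : HasMFDerivAt 𝓘(ℝ, F) 𝓘(ℝ, ES) f u f') (hx : HasMFDerivAt 𝓘(ℝ, F) 𝓘(ℝ, E) x u x')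
    (hg : HasMFDerivAt 𝓘(ℝ, F) 𝓘(ℝ, ES) (fun u' => act (f u') (x u')) u g')
    (hp : HasFDerivAt (fun u' => J (act (f u') (x u'))) p' u) (v w : F) :
    (Ω (act (f u) (x u)) : ES [⋀^Fin 2]→L[ℝ] ℝ) ![g' v, g' w] =
      (Ω (f u) : ES [⋀^Fin 2]→L[ℝ] ℝ) ![f' v, f' w] +
      (cotangentForm E G (x u, J (act (f u) (x u))) : (E × (E →L[ℝ] ℝ)) [⋀^Fin 2]→L[ℝ] ℝ)
        ![(x' v, p' v), (x' w, p' w)] := by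
  obtain ⟨t, ht⟩ : ∃ t, t = act (f u) (x u) := ⟨_, rfl⟩
  obtain ⟨β, hβ⟩ : ∃ β : ES [⋀^Fin 2]→L[ℝ] ℝ, β = Ω t := ⟨_, rfl⟩
  obtain ⟨A, hA⟩ : ∃ A : ES →L[ℝ] ES,
    A = mfderiv 𝓘(ℝ, ES) 𝓘(ℝ, ES) (fun s => act s (x u)) (f u) := ⟨_, rfl⟩
  obtain ⟨X, hX⟩ : ∃ X : E → ES, ∀ ξ, X ξ = generator 𝓘(ℝ, ES) act ξ t := ⟨_, fun _ => rfl⟩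
  obtain ⟨l, hl⟩ : ∃ l : E →L[ℝ] E, l = leftTriv (x u) := ⟨_, rfl⟩
  -- The velocity of f·x splits into the velocity of f, translated by x, and a vector tangent to the
  -- orbit.
  have hd : ∀ v : F, g' v = A (f' v) + X (l (x' v)) := by
    intro v
    have h1 := HasMFDerivAt.comp u (hS.smooth_act.mdifferentiable (by simp) (f u, x u)).hasMFDerivAt
      (hf.prodMk hx)
    have h2 := congrArg (fun T : F →L[ℝ] ES => T v) (hasMFDerivAt_unique hg h1)
    refine h2.trans ?_
    have h3 := mfderiv_prod_eq_add_apply (hS.smooth_act.mdifferentiable (by simp) (f u, x u))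
      (v := (f' v, x' v))
    rw [hA, hX, hl, ht]
    refine Eq.trans ?_ (h3.trans ?_)
    · rfl
    · exact congrArg₂ (fun a b : ES => a + b) rfl (hS.mfderiv_act_right (f u) (x u) _)
  -- The moment map condition along f·x: it turns the terms of dθ_L that contain a variation of p
  -- into values of Ω.
  have hp : ∀ (v : F) (η : E), p' v η = β ![g' v, X η] := by
    intro v η
    rw [hX, hβ, ht]
    have h2 := HasMFDerivAt.comp u
      (hS.smooth_J.mdifferentiable (by simp) (act (f u) (x u))).hasMFDerivAt hg
    have h3 := congrArg (fun T : F →L[ℝ] (E →L[ℝ] ℝ) => T v η)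
      (hp.unique (hasMFDerivAt_iff_hasFDerivAt.1 h2))
    exact h3.trans (hS.moment (act (f u) (x u)) η (g' v))
  have hinv : ∀ a b : ES, β ![A a, A b] =
      (Ω (f u) : ES [⋀^Fin 2]→L[ℝ] ℝ) ![a, b] := by
    intro a b
    rw [← hS.invariant (x u) (f u), hA, hβ, ht]
    refine congrArg (Ω (act (f u) (x u)) : ES [⋀^Fin 2]→L[ℝ] ℝ) ?_
    ext i
    fin_cases i <;> rfl
  have hgen : ∀ ξ η : E, β ![X ξ, X η] = J t (lieBr G ξ η) := by
    intro ξ η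
    rw [hX, hX, hβ]
    exact hS.apply_generator_generator t ξ η
  have hc := cotangentForm_apply (E := E) (x u, J (act (f u) (x u))) (x' v) (x' w) (p' v) (p' w)
  rw [← ht] at hc ⊢
  rw [hc, ← hβ, ← hl, hp, hp, ← hgen]
  have h := alternating_two_add β (A (f' v)) (A (f' w))
    (X (l (x' v))) (X (l (x' w)))
  rw [hinv, ← hd, ← hd] at h
  have harith : ∀ a b c d : ℝ, a + b - c - d = a + (b - c - d) := fun a b c d => by ring
  exact h.trans (harith _ _ _ _)

end

/-! ### Transport of manifold and symplectic structures along a bijection. -/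

section Transport

variable {E : Type*} [NormedAddCommGroup E] [NormedSpace ℝ E] {P Q : Type*}

/-- The charted space structure transported along a homeomorphism. -/
abbrev chartedSpaceTransport [TopologicalSpace P] [TopologicalSpace Q] [ChartedSpace E Q]
    (e : P ≃ₜ Q) : ChartedSpace E P where
  atlas := (fun c => e.transOpenPartialHomeomorph c) '' atlas E Q
  chartAt p := e.transOpenPartialHomeomorph (chartAt E (e p))
  mem_chart_source p := mem_chart_source E (e p)
  chart_mem_atlas p := mem_image_of_mem _ (chart_mem_atlas E (e p))

variable [TopologicalSpace P] [TopologicalSpace Q] [ChartedSpace E Q] [ChartedSpace E P]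

theorem isManifold_transport [IsManifold 𝓘(ℝ, E) ∞ Q] (e : P ≃ₜ Q)
    (hat : atlas E P = (fun c => e.transOpenPartialHomeomorph c) '' atlas E Q) :
    IsManifold 𝓘(ℝ, E) ∞ P where
  compatible := by
    intro c c' hc hc'
    rw [hat] at hc hc'
    obtain ⟨d, hd, rfl⟩ := hc
    obtain ⟨d', hd', rfl⟩ := hc'
    have h : (e.transOpenPartialHomeomorph d).symm.trans (e.transOpenPartialHomeomorph d') =
        d.symm.trans d' := by
      refine OpenPartialHomeomorph.ext _ _ (fun x => ?_) (fun x => ?_) ?_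
      · simp
      · simp
      · ext x
        simp
    rw [h]
    exact HasGroupoid.compatible hd hd'

theorem contMDiff_transport [IsManifold 𝓘(ℝ, E) ∞ Q] (e : P ≃ₜ Q)
    (hch : ∀ p : P, chartAt E p = e.transOpenPartialHomeomorph (chartAt E (e p))) :
    ContMDiff 𝓘(ℝ, E) 𝓘(ℝ, E) ∞ e := by
  intro p
  rw [contMDiffAt_iff]
  refine ⟨e.continuous.continuousAt, ?_⟩
  refine (contDiffWithinAt_id).congr_of_eventuallyEq_of_mem ?_ (by simp)
  filter_upwards [nhdsWithin_le_nhds (extChartAt_target_mem_nhds (I := 𝓘(ℝ, E)) p)] with y hy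
  simp only [extChartAt, hch, OpenPartialHomeomorph.extend, Function.comp] at hy ⊢
  simp at hy ⊢
  exact (chartAt E (e p)).right_inv hy

theorem contMDiff_symm_transport [IsManifold 𝓘(ℝ, E) ∞ Q] (e : P ≃ₜ Q)
    (hch : ∀ p : P, chartAt E p = e.transOpenPartialHomeomorph (chartAt E (e p))) :
    ContMDiff 𝓘(ℝ, E) 𝓘(ℝ, E) ∞ e.symm := by
  intro q
  rw [contMDiffAt_iff]
  refine ⟨e.symm.continuous.continuousAt, ?_⟩
  refine (contDiffWithinAt_id).congr_of_eventuallyEq_of_mem ?_ (by simp)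
  filter_upwards [nhdsWithin_le_nhds (extChartAt_target_mem_nhds (I := 𝓘(ℝ, E)) q)] with y hy
  simp only [extChartAt, hch, OpenPartialHomeomorph.extend, Function.comp] at hy ⊢
  simp at hy ⊢
  exact (chartAt E q).right_inv hy

/-- The inverse of a transported chart, followed by e, is the inverse of the original chart. So form
and pulled-back form have literally the same coordinates, and smoothness and closedness carry over
without computation. -/
theorem inChart_transport [IsManifold 𝓘(ℝ, E) ∞ Q] [IsManifold 𝓘(ℝ, E) ∞ P] (e : P ≃ₜ Q)
    (hch : ∀ p : P, chartAt E p = e.transOpenPartialHomeomorph (chartAt E (e p)))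
    {k : ℕ} (Ω : DiffForm 𝓘(ℝ, E) Q k) (Ω' : DiffForm 𝓘(ℝ, E) P k)
    (hΩ' : ∀ p, Ω' p = (Ω (e p)).compContinuousLinearMap (mfderiv 𝓘(ℝ, E) 𝓘(ℝ, E) e p)) (p : P)
    {y : E} (hy : y ∈ (extChartAt 𝓘(ℝ, E) p).target) :
    inChart Ω' p y = inChart Ω (e p) y := by
  have h1 : HasMFDerivAt 𝓘(ℝ, E) 𝓘(ℝ, E) (extChartAt 𝓘(ℝ, E) p).symm y
      (mfderiv 𝓘(ℝ, E) 𝓘(ℝ, E) (extChartAt 𝓘(ℝ, E) p).symm y) :=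
    ((contMDiffAt_extChartAt_symm p hy).mdifferentiableAt (by simp)).hasMFDerivAt
  have h2 := HasMFDerivAt.comp y
    ((contMDiff_transport e hch).mdifferentiable (by simp) ((extChartAt 𝓘(ℝ, E) p).symm y)).hasMFDerivAt h1
  have h3 : e ∘ (extChartAt 𝓘(ℝ, E) p).symm = (extChartAt 𝓘(ℝ, E) (e p)).symm := by
    ext z
    simp [extChartAt, hch, OpenPartialHomeomorph.extend]
  rw [h3] at h2
  ext v
  have h4 : e ((extChartAt 𝓘(ℝ, E) p).symm y) = (extChartAt 𝓘(ℝ, E) (e p)).symm y := congrFun h3 y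
  have h5 : ∀ w : E, (mfderiv 𝓘(ℝ, E) 𝓘(ℝ, E) (extChartAt 𝓘(ℝ, E) (e p)).symm y w : E) =
      (mfderiv 𝓘(ℝ, E) 𝓘(ℝ, E) e ((extChartAt 𝓘(ℝ, E) p).symm y)
        (mfderiv 𝓘(ℝ, E) 𝓘(ℝ, E) (extChartAt 𝓘(ℝ, E) p).symm y w) : E) := fun w =>
    congrArg (fun T : E →L[ℝ] E => T w) h2.mfderiv
  have h6 : (inChart Ω (e p) y : E [⋀^Fin k]→L[ℝ] ℝ) v =
      (Ω (e ((extChartAt 𝓘(ℝ, E) p).symm y)) : E [⋀^Fin k]→L[ℝ] ℝ)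
        (fun i => mfderiv 𝓘(ℝ, E) 𝓘(ℝ, E) (extChartAt 𝓘(ℝ, E) (e p)).symm y (v i)) := by
    rw [h4]; rfl
  rw [h6]
  unfold inChart
  rw [hΩ']
  exact congrArg (Ω (e ((extChartAt 𝓘(ℝ, E) p).symm y)) : E [⋀^Fin k]→L[ℝ] ℝ)
    (funext fun i => (h5 (v i)).symm)

end Transport

/-- A symplectic manifold structure can be transported along a bijection. -/
theorem exists_symplectic_transport {E : Type*} [NormedAddCommGroup E] [NormedSpace ℝ E]
    {P Q : Type*} [TopologicalSpace Q] [ChartedSpace E Q] [IsManifold 𝓘(ℝ, E) ∞ Q] [T2Space Q]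
    [SecondCountableTopology Q] (e : P ≃ Q) (Ω : DiffForm 𝓘(ℝ, E) Q 2) (hΩ : IsSymplectic Ω) :
    ∃ (_ : TopologicalSpace P) (_ : ChartedSpace E P) (Ω' : DiffForm 𝓘(ℝ, E) P 2),
      T2Space P ∧ SecondCountableTopology P ∧ IsManifold 𝓘(ℝ, E) ∞ P ∧ IsSymplectic Ω' ∧
      IsSymplectomorphism Ω' Ω e := by
  let tP : TopologicalSpace P := TopologicalSpace.induced e inferInstance
  let h : P ≃ₜ Q := e.toHomeomorphOfIsInducing ⟨rfl⟩
  let cP : ChartedSpace E P := chartedSpaceTransport h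
  have hch : ∀ p : P, chartAt E p = h.transOpenPartialHomeomorph (chartAt E (h p)) := fun _ => rfl
  have mP : IsManifold 𝓘(ℝ, E) ∞ P := isManifold_transport h rfl
  have mP1 : IsManifold 𝓘(ℝ, E) 1 P := IsManifold.of_le (n := ∞) (by norm_cast)
  have mQ1 : IsManifold 𝓘(ℝ, E) 1 Q := IsManifold.of_le (n := ∞) (by norm_cast)
  have hs := contMDiff_transport h hch
  have hs' := contMDiff_symm_transport h hch
  let Ω' : DiffForm 𝓘(ℝ, E) P 2 := fun p =>
    (Ω (e p)).compContinuousLinearMap (mfderiv 𝓘(ℝ, E) 𝓘(ℝ, E) e p)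
  have hin := fun p y => inChart_transport h hch Ω Ω' (fun _ => rfl) p (y := y)
  have htar : ∀ p, (extChartAt 𝓘(ℝ, E) p).target = (extChartAt 𝓘(ℝ, E) (h p)).target := by
    intro p
    simp [extChartAt, hch, OpenPartialHomeomorph.extend]
  refine ⟨tP, cP, Ω', h.isEmbedding.t2Space, h.isEmbedding.secondCountableTopology, mP,
    ⟨?_, ?_, ?_⟩, ⟨hs, hs', fun _ => rfl⟩⟩
  · intro p
    refine ContDiffOn.congr ?_ (hin p)
    rw [htar]
    exact hΩ.smooth (h p)
  · intro p
    have h1 := extD_apply Ω' p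
    have h2 := extD_apply Ω (h p)
    have h3 : inChart Ω' p =ᶠ[𝓝 (extChartAt 𝓘(ℝ, E) p p)] inChart Ω (h p) := by
      filter_upwards [extChartAt_target_mem_nhds p] with y hy
      exact hin p y hy
    rw [h3.extDeriv_eq] at h1
    exact h1.trans (h2.symm.trans (hΩ.closed (h p)))
  · intro p v hv
    have h1 := HasMFDerivAt.comp p (hs'.mdifferentiable (by simp) (h p)).hasMFDerivAt
      (hs.mdifferentiable (by simp) p).hasMFDerivAt
    have h0 : HasMFDerivAt 𝓘(ℝ, E) 𝓘(ℝ, E) h (h.symm (h p))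
        (mfderiv 𝓘(ℝ, E) 𝓘(ℝ, E) h p : E →L[ℝ] E) := by
      rw [h.symm_apply_apply]
      exact (hs.mdifferentiable (by simp) p).hasMFDerivAt
    have h2 := HasMFDerivAt.comp (h p) h0 (hs'.mdifferentiable (by simp) (h p)).hasMFDerivAt
    rw [show h.symm ∘ h = id by ext; simp] at h1
    rw [show h ∘ h.symm = id by ext; simp] at h2
    have h3 := hasMFDerivAt_unique h1 (hasMFDerivAt_id p)
    have h4 := hasMFDerivAt_unique h2 (hasMFDerivAt_id (h p))
    -- Every tangent vector w of Q is the image of a tangent vector of P under the derivative of h,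
    -- so the image of v is in the kernel of Ω.
    have h5 : mfderiv 𝓘(ℝ, E) 𝓘(ℝ, E) h p v = (0 : E) := by
      refine hΩ.nondegenerate (h p) _ fun w => ?_
      have h6 := hv (mfderiv 𝓘(ℝ, E) 𝓘(ℝ, E) h.symm (h p) w)
      have h7 : mfderiv 𝓘(ℝ, E) 𝓘(ℝ, E) h p (mfderiv 𝓘(ℝ, E) 𝓘(ℝ, E) h.symm (h p) w) = w :=
        congrArg (fun T : E →L[ℝ] E => T w) h4
      refine Eq.trans ?_ h6
      refine congrArg (Ω (h p) : E [⋀^Fin 2]→L[ℝ] ℝ) ?_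
      funext i
      fin_cases i
      · rfl
      · exact h7.symm
    have h6 : _ = v := congrArg (fun T : E →L[ℝ] E => T v) h3
    rw [← h6]
    exact (congrArg (mfderiv 𝓘(ℝ, E) 𝓘(ℝ, E) h.symm (h p) : E →L[ℝ] E) h5).trans (map_zero _)

/-! ### Smooth maps to quotients, on manifolds -/

section SmoothMaps

variable {F : Type*} [NormedAddCommGroup F] [NormedSpace ℝ F]
  {N : Type*} [TopologicalSpace N] [ChartedSpace F N]

theorem isOpen_extChartAt_symm_preimage {V : Set N} (hV : IsOpen V) (q : N) :
    IsOpen ((extChartAt 𝓘(ℝ, F) q).target ∩ (extChartAt 𝓘(ℝ, F) q).symm ⁻¹' V) :=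
  (continuousOn_extChartAt_symm q).isOpen_inter_preimage (isOpen_extChartAt_target q) hV

/-- The reduced structures test smoothness only on families over open sets of Euclidean spaces.
Together with its converse below, this extends the tests to families over manifolds, which is what
local sections of a quotient are. -/
theorem contMDiffOn_of_comp_extChartAt_symm {E' : Type*} [NormedAddCommGroup E'] [NormedSpace ℝ E']
    {B' : Type*} [TopologicalSpace B'] {I' : ModelWithCorners ℝ E' B'} {M' : Type*}
    [TopologicalSpace M'] [ChartedSpace B' M'] {g : N → M'} {V : Set N} (hV : IsOpen V)
    (hg : ∀ q ∈ V, ContMDiffOn 𝓘(ℝ, F) I' ∞ (fun u => g ((extChartAt 𝓘(ℝ, F) q).symm u))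
      ((extChartAt 𝓘(ℝ, F) q).target ∩ (extChartAt 𝓘(ℝ, F) q).symm ⁻¹' V)) :
    ContMDiffOn 𝓘(ℝ, F) I' ∞ g V := by
  intro q hq
  refine ContMDiffAt.contMDiffWithinAt ?_
  have h1 := (hg q hq).contMDiffAt ((isOpen_extChartAt_symm_preimage hV q).mem_nhds
    ⟨mem_extChartAt_target q, by simpa using hq⟩)
  have h2 := ContMDiffAt.comp q h1 contMDiffAt_extChartAt
  refine h2.congr_of_eventuallyEq ?_
  filter_upwards [extChartAt_source_mem_nhds (I := 𝓘(ℝ, F)) q] with y hy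
  simp only [Function.comp]
  rw [(extChartAt 𝓘(ℝ, F) q).left_inv hy]

variable [IsManifold 𝓘(ℝ, F) ∞ N]

theorem contMDiffOn_comp_extChartAt_symm {E' : Type*} [NormedAddCommGroup E'] [NormedSpace ℝ E']
    {B' : Type*} [TopologicalSpace B'] {I' : ModelWithCorners ℝ E' B'} {M' : Type*}
    [TopologicalSpace M'] [ChartedSpace B' M'] {g : N → M'} {V : Set N}
    (hg : ContMDiffOn 𝓘(ℝ, F) I' ∞ g V) (q : N) :
    ContMDiffOn 𝓘(ℝ, F) I' ∞ (fun u => g ((extChartAt 𝓘(ℝ, F) q).symm u))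
      ((extChartAt 𝓘(ℝ, F) q).target ∩ (extChartAt 𝓘(ℝ, F) q).symm ⁻¹' V) :=
  hg.comp ((contMDiffOn_extChartAt_symm q).mono inter_subset_left) (fun _ hu => hu.2)

end SmoothMaps

section OrbitSmooth

variable {E : Type*} [NormedAddCommGroup E] [NormedSpace ℝ E]
  {G : Type*} [Group G] [TopologicalSpace G] [ChartedSpace E G]
  {F : Type*} [NormedAddCommGroup F] [NormedSpace ℝ F]
  {N : Type*} [TopologicalSpace N] [ChartedSpace F N]
  {F' : Type*} [NormedAddCommGroup F'] [NormedSpace ℝ F']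
  {N' : Type*} [TopologicalSpace N'] [ChartedSpace F' N']

theorem IsSmoothIntoOrbit.comp {O : Set (E →L[ℝ] ℝ)} {θ : N → E →L[ℝ] ℝ} {V : Set N}
    (h : IsSmoothIntoOrbit G (F := F) O θ V) {g : N' → N} {U : Set N'} (hU : IsOpen U)
    (hg : ContMDiffOn 𝓘(ℝ, F') 𝓘(ℝ, F) ∞ g U) (hUV : MapsTo g U V) :
    IsSmoothIntoOrbit G (F := F') O (fun u => θ (g u)) U := by
  intro u hu
  obtain ⟨V', hV', huV', μ, hμ, x, hx, hθ⟩ := h (g u) (hUV hu)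
  refine ⟨U ∩ g ⁻¹' V', hg.continuousOn.isOpen_inter_preimage hU hV', ⟨hu, huV'⟩, μ, hμ, x ∘ g,
    hx.comp (hg.mono inter_subset_left) (fun _ h => h.2), fun u' hu' => hθ _ hu'.2⟩

theorem IsSmoothIntoOrbit.congr {O : Set (E →L[ℝ] ℝ)} {θ θ' : N → E →L[ℝ] ℝ} {V V' : Set N}
    (h : IsSmoothIntoOrbit G (F := F) O θ V) (hV' : IsOpen V') (hVV' : V' ⊆ V)
    (hθ : ∀ q ∈ V', θ' q = θ q) : IsSmoothIntoOrbit G (F := F) O θ' V' := by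
  intro u hu
  obtain ⟨V₁, hV₁, huV₁, μ, hμ, x, hx, hθ₁⟩ := h u (hVV' hu)
  exact ⟨V₁ ∩ V', hV₁.inter hV', ⟨huV₁, hu⟩, μ, hμ, x, hx.mono inter_subset_left,
    fun u' hu' => (hθ u' hu'.2).trans (hθ₁ u' hu'.1)⟩

end OrbitSmooth

section Reduction

variable {E : Type*} [NormedAddCommGroup E] [NormedSpace ℝ E]
  {G : Type*} [Group G] [TopologicalSpace G] [ChartedSpace E G]
  {ES : Type*} [NormedAddCommGroup ES] [NormedSpace ℝ ES]
  {B : Type*} [TopologicalSpace B] {IS : ModelWithCorners ℝ ES B}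
  {S : Type*} [TopologicalSpace S] [ChartedSpace B S]
  {Ω : DiffForm IS S 2} {act : S → G → S} {J : S → E →L[ℝ] ℝ}
  {k : ℕ} {N : Type*} [TopologicalSpace N] [ChartedSpace (EuclideanSpace ℝ (Fin k)) N]
  [IsManifold (𝓡 k) ∞ N]

theorem IsOrbitReduction.contMDiffOn_mk {O : Set (E →L[ℝ] ℝ)} {n : ℕ}
    [TopologicalSpace (OrbitSpace act J O)]
    [ChartedSpace (EuclideanSpace ℝ (Fin n)) (OrbitSpace act J O)]
    {ΩQ : DiffForm (𝓡 n) (OrbitSpace act J O) 2} (h : IsOrbitReduction Ω act J O ΩQ)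
    {V : Set N} (hV : IsOpen V) {f : N → {s : S // J s ∈ O}}
    (hf : ContMDiffOn (𝓡 k) IS ∞ (fun q => (f q).1) V)
    (hθ : IsSmoothIntoOrbit G (F := EuclideanSpace ℝ (Fin k)) O (fun q => J (f q).1) V) :
    ContMDiffOn (𝓡 k) (𝓡 n) ∞ (fun q => OrbitSpace.mk act J O (f q)) V :=
  contMDiffOn_of_comp_extChartAt_symm hV fun q _ =>
    h.smooth_mk k _ (isOpen_extChartAt_symm_preimage hV q)
      (fun u => f ((extChartAt (𝓡 k) q).symm u)) (contMDiffOn_comp_extChartAt_symm hf q)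
      (hθ.comp (isOpen_extChartAt_symm_preimage hV q)
        ((contMDiffOn_extChartAt_symm q).mono inter_subset_left) (fun _ hu => hu.2))

variable {EX : Type*} [NormedAddCommGroup EX] [NormedSpace ℝ EX]
  {BX : Type*} [TopologicalSpace BX] {IX : ModelWithCorners ℝ EX BX}
  {X : Type*} [TopologicalSpace X] [ChartedSpace BX X] {ΩX : DiffForm IX X 2} {actX : G → X → X}
  {ρ : X → E →L[ℝ] ℝ}

theorem IsInduction.contMDiffOn_mk {n : ℕ} [TopologicalSpace (InducedSpace act J actX ρ)]
    [ChartedSpace (EuclideanSpace ℝ (Fin n)) (InducedSpace act J actX ρ)]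
    {ΩQ : DiffForm (𝓡 n) (InducedSpace act J actX ρ) 2} (h : IsInduction Ω act J ΩX actX ρ ΩQ)
    {V : Set N} (hV : IsOpen V) {f : N → {q : S × X // J q.1 = ρ q.2}}
    (hf₁ : ContMDiffOn (𝓡 k) IS ∞ (fun q => (f q).1.1) V)
    (hf₂ : ContMDiffOn (𝓡 k) IX ∞ (fun q => (f q).1.2) V) :
    ContMDiffOn (𝓡 k) (𝓡 n) ∞ (fun q => InducedSpace.mk act J actX ρ (f q)) V :=
  contMDiffOn_of_comp_extChartAt_symm hV fun q _ =>
    h.smooth_mk k _ (isOpen_extChartAt_symm_preimage hV q)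
      (fun u => f ((extChartAt (𝓡 k) q).symm u)) (contMDiffOn_comp_extChartAt_symm hf₁ q)
      (contMDiffOn_comp_extChartAt_symm hf₂ q)

end Reduction

/-! ### Points of the quotients -/

section Points

theorem OrbitSpace.mk_eq_mk_iff {E : Type*} [NormedAddCommGroup E] [NormedSpace ℝ E]
    {G : Type*} [Group G] {S : Type*} {act : S → G → S} {J : S → E →L[ℝ] ℝ} {O : Set (E →L[ℝ] ℝ)}
    (h1 : ∀ s, act s 1 = s) (hmul : ∀ s x y, act s (x * y) = act (act s x) y)
    {a b : {s : S // J s ∈ O}} :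
    OrbitSpace.mk act J O a = OrbitSpace.mk act J O b ↔ ∃ x : G, b.1 = act a.1 x := by
  refine ⟨fun h => ?_, fun h => Quot.sound h⟩
  have he : Equivalence (fun a b : {s : S // J s ∈ O} => ∃ x : G, b.1 = act a.1 x) :=
    ⟨fun a => ⟨1, (h1 _).symm⟩,
      fun {a b} ⟨x, hx⟩ => ⟨x⁻¹, by rw [hx, ← hmul, mul_inv_cancel, h1]⟩,
      fun {a b c} ⟨x, hx⟩ ⟨y, hy⟩ => ⟨x * y, by rw [hy, hx, hmul]⟩⟩
  exact (he.eqvGen_iff).1 (Quot.eqvGen_exact h)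

theorem InducedSpace.mk_eq_mk_iff {E : Type*} [NormedAddCommGroup E] [NormedSpace ℝ E]
    {G : Type*} [Group G] {S X : Type*} {act : S → G → S} {J : S → E →L[ℝ] ℝ}
    {actX : G → X → X} {ρ : X → E →L[ℝ] ℝ}
    (h1 : ∀ s, act s 1 = s) (hmul : ∀ s x y, act s (x * y) = act (act s x) y)
    (h1' : ∀ z, actX 1 z = z) (hmul' : ∀ x y z, actX (x * y) z = actX x (actX y z))
    {a b : {q : S × X // J q.1 = ρ q.2}} :
    InducedSpace.mk act J actX ρ a = InducedSpace.mk act J actX ρ b ↔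
      ∃ x : G, b.1 = (act a.1.1 x, actX x⁻¹ a.1.2) := by
  refine ⟨fun h => ?_, fun h => Quot.sound h⟩
  have he : Equivalence (fun a b : {q : S × X // J q.1 = ρ q.2} =>
      ∃ x : G, b.1 = (act a.1.1 x, actX x⁻¹ a.1.2)) :=
    ⟨fun a => ⟨1, by rw [h1, inv_one, h1']⟩,
      fun {a b} ⟨x, hx⟩ => ⟨x⁻¹, by
        rw [hx]; simp only [← hmul, mul_inv_cancel, h1, ← hmul', inv_inv, h1']⟩,
      fun {a b c} ⟨x, hx⟩ ⟨y, hy⟩ => ⟨x * y, by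
        rw [hy, hx]; simp only [← hmul, ← hmul', mul_inv_rev]⟩⟩
  exact (he.eqvGen_iff).1 (Quot.eqvGen_exact h)

variable {E : Type*} [NormedAddCommGroup E] [NormedSpace ℝ E]
  {G : Type*} [Group G] [TopologicalSpace G] [ChartedSpace E G]
  {H : Subgroup G}

theorem cotangentAct_one (z : Cotangent E G) : cotangentAct H z 1 = z := by
  simp only [cotangentAct, OneMemClass.coe_one, inv_one, coAd_one, mul_one]

variable [LieGroup 𝓘(ℝ, E) ∞ G]

theorem cotangentAct_mul (z : Cotangent E G) (h h' : H) :
    cotangentAct H z (h * h') = cotangentAct H (cotangentAct H z h) h' := by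
  simp only [cotangentAct, Subgroup.coe_mul, mul_inv_rev, coAd_mul, mul_assoc]

variable {EH : Type*} [NormedAddCommGroup EH] [NormedSpace ℝ EH] [ChartedSpace EH H]
  {O : Set (EH →L[ℝ] ℝ)}

theorem ReducedCotangent.mk_eq_mk_iff {x y : G} {p q : E →L[ℝ] ℝ} {hp : restrictDual H p ∈ O}
    {hq : restrictDual H q ∈ O} :
    ReducedCotangent.mk H O x p hp = ReducedCotangent.mk H O y q hq ↔
      ∃ h : H, (y, q) = (x * h, coAd (h : G)⁻¹ p) :=
  OrbitSpace.mk_eq_mk_iff cotangentAct_one cotangentAct_mul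

theorem ReducedCotangent.exists_rep (z : ReducedCotangent (E := E) H O) :
    ∃ x p hp, z = ReducedCotangent.mk H O x p hp := by
  obtain ⟨⟨⟨x, p⟩, hp⟩, rfl⟩ := Quot.exists_rep z
  exact ⟨x, p, hp, rfl⟩

theorem ReducedCotangent.act_mk (y x : G) (p : E →L[ℝ] ℝ) (hp : restrictDual H p ∈ O) :
    ReducedCotangent.act (E := E) H O y (ReducedCotangent.mk H O x p hp) =
      ReducedCotangent.mk H O (y * x) p hp := rfl

theorem ReducedCotangent.moment_mk (x : G) (p : E →L[ℝ] ℝ) (hp : restrictDual H p ∈ O) :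
    ReducedCotangent.moment H O (ReducedCotangent.mk H O x p hp) = coAd x p := rfl

theorem ReducedCotangent.act_one (z : ReducedCotangent (E := E) H O) :
    ReducedCotangent.act (E := E) H O 1 z = z := by
  obtain ⟨x, p, hp, rfl⟩ := z.exists_rep
  simp only [ReducedCotangent.act_mk, one_mul]

theorem ReducedCotangent.act_mul (x y : G) (z : ReducedCotangent (E := E) H O) :
    ReducedCotangent.act (E := E) H O (x * y) z =
      ReducedCotangent.act (E := E) H O x (ReducedCotangent.act (E := E) H O y z) := by
  obtain ⟨x, p, hp, rfl⟩ := z.exists_rep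
  simp only [ReducedCotangent.act_mk, mul_assoc]

variable {ES : Type*} [NormedAddCommGroup ES] [NormedSpace ℝ ES]
  {S : Type*} [TopologicalSpace S] [ChartedSpace ES S]
  {Ω : DiffForm 𝓘(ℝ, ES) S 2} {act : S → G → S} {J : S → E →L[ℝ] ℝ}

theorem IsStronglyHamiltonian.moment_act_eq (hS : IsStronglyHamiltonian Ω act J) {s : S} {x : G}
    {p : E →L[ℝ] ℝ} (h : J s = coAd x p) : J (act s x) = p := by
  rw [hS.equivariant, h, ← coAd_mul, inv_mul_cancel, coAd_one]

/-- The point `(s, [x, J(s x)]_H)` over a point `t = s x` with `J(t)|𝔥` in `O`. -/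
def stagePoint (hS : IsStronglyHamiltonian Ω act J) (x : G)
    (a : {s : S // restrictDual H (J s) ∈ O}) :
    {q : S × ReducedCotangent (E := E) H O // J q.1 = ReducedCotangent.moment H O q.2} :=
  ⟨(act a.1 x⁻¹, ReducedCotangent.mk H O x (J a.1) a.2), by
    rw [ReducedCotangent.moment_mk, hS.equivariant, inv_inv]⟩

/-- The map `[s]_H ↦ [s, [1, J(s)]_H]_G`, inverse to `W`. -/
def stageMap (hS : IsStronglyHamiltonian Ω act J) :
    OrbitSpace (fun s (h : H) => act s (h : G)) (fun s => restrictDual H (J s)) O →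
      InducedSpace act J (ReducedCotangent.act (E := E) H O) (ReducedCotangent.moment H O) :=
  Quot.lift (fun a => InducedSpace.mk _ _ _ _ (stagePoint hS 1 a)) (by
    rintro a b ⟨h, hb⟩
    -- The element h of H, viewed in G, relates the two pairs: h⁻¹[1, J(s)]_H = [h⁻¹, J(s)]_H, and
    -- the right action of h takes this representative to (1, J(sh)).
    refine Quot.sound ⟨h, ?_⟩
    simp only [stagePoint, inv_one, hS.act_one, ReducedCotangent.act_mk, Prod.mk.injEq]
    refine ⟨hb, (ReducedCotangent.mk_eq_mk_iff.2 ⟨h, ?_⟩).symm⟩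
    rw [hb, hS.equivariant, mul_one, inv_mul_cancel])

/-- Acting by x takes (tx⁻¹, [x, J(t)]_H) to (t, [1, J(t)]_H). The freedom in x is used later to
make a local section pass through a prescribed point. -/
theorem mk_stagePoint (hS : IsStronglyHamiltonian Ω act J) (x : G)
    (a : {s : S // restrictDual H (J s) ∈ O}) :
    InducedSpace.mk act J (ReducedCotangent.act (E := E) H O) (ReducedCotangent.moment H O)
      (stagePoint hS x a) = stageMap hS (OrbitSpace.mk _ _ O a) := by
  refine Quot.sound ⟨x, ?_⟩
  simp only [stagePoint, inv_one, hS.act_one, ReducedCotangent.act_mk, ← hS.act_mul,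
    inv_mul_cancel]

/-- Since J(sx) = p, the pair (s, [x,p]_H) is itself `stagePoint` of sx with parameter x. This is
the formula for W, read backwards. -/
theorem mk_eq_stageMap (hS : IsStronglyHamiltonian Ω act J) {s : S} {x : G} {p : E →L[ℝ] ℝ}
    (hp : restrictDual H p ∈ O)
    (hs : J s = ReducedCotangent.moment H O (ReducedCotangent.mk H O x p hp))
    (hsx : restrictDual H (J (act s x)) ∈ O) :
    InducedSpace.mk act J (ReducedCotangent.act (E := E) H O) (ReducedCotangent.moment H O)
      ⟨(s, ReducedCotangent.mk H O x p hp), hs⟩ = stageMap hS (OrbitSpace.mk _ _ O ⟨act s x, hsx⟩) := by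
  rw [← mk_stagePoint hS x]
  congr 1
  have hJ := hS.moment_act_eq (hs.trans (ReducedCotangent.moment_mk x p hp))
  simp only [stagePoint, ← hS.act_mul, mul_inv_cancel, hS.act_one, hJ]

theorem bijective_stageMap (hS : IsStronglyHamiltonian Ω act J) :
    Function.Bijective (stageMap (H := H) (O := O) hS) := by
  constructor
  · intro a b hab
    obtain ⟨⟨s, hs⟩, rfl⟩ := Quot.exists_rep a
    obtain ⟨⟨t, ht⟩, rfl⟩ := Quot.exists_rep b
    obtain ⟨x, hx⟩ := (InducedSpace.mk_eq_mk_iff hS.act_one hS.act_mul ReducedCotangent.act_one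
      ReducedCotangent.act_mul).1 hab
    simp only [stagePoint, inv_one, hS.act_one, ReducedCotangent.act_mk, Prod.mk.injEq] at hx
    -- Equality of the classes [1, J(t)]_H and [x⁻¹, J(s)]_H forces x⁻¹ to be in H; this is how a
    -- G-equivalence becomes an H-equivalence.
    obtain ⟨h, hh⟩ := ReducedCotangent.mk_eq_mk_iff.1 hx.2
    simp only [Prod.mk.injEq, mul_one, one_mul] at hh
    refine Quot.sound ⟨h⁻¹, ?_⟩
    simp only [hx.1, Subgroup.coe_inv, ← hh.1, inv_inv]
  · intro c
    obtain ⟨⟨⟨s, z⟩, hs⟩, rfl⟩ := Quot.exists_rep c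
    obtain ⟨x, p, hp, rfl⟩ := z.exists_rep
    have hJ := hS.moment_act_eq (hs.trans (ReducedCotangent.moment_mk x p hp))
    exact ⟨_, (mk_eq_stageMap hS hp hs (by rw [hJ]; exact hp)).symm⟩

end Points

/-! ### Pull-backs of 2-forms by maps from Euclidean spaces -/

section FormPullback

variable {F : Type*} [NormedAddCommGroup F] [NormedSpace ℝ F]
  {E : Type*} [NormedAddCommGroup E] [NormedSpace ℝ E]
  {B : Type*} [TopologicalSpace B] {I : ModelWithCorners ℝ E B}
  {M : Type*} [TopologicalSpace M] [ChartedSpace B M]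
  {E' : Type*} [NormedAddCommGroup E'] [NormedSpace ℝ E']
  {B' : Type*} [TopologicalSpace B'] {I' : ModelWithCorners ℝ E' B'}
  {M' : Type*} [TopologicalSpace M'] [ChartedSpace B' M']

/-- The value at `u` of the pull-back of the form `Ω` by `f`. -/
def formPullback (Ω : DiffForm I M 2) (f : F → M) (u v w : F) : ℝ :=
  Ω (f u) ![mfderiv 𝓘(ℝ, F) I f u v, mfderiv 𝓘(ℝ, F) I f u w]

/-- The values of f and g at u are equal only propositionally, so the tangent vectors are first
regarded as elements of the model space E. -/
theorem formPullback_congr (Ω : DiffForm I M 2) {f g : F → M} {u : F} (h : f =ᶠ[𝓝 u] g) (v w : F) :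
    formPullback Ω f u v w = formPullback Ω g u v w := by
  obtain ⟨A, hA⟩ : ∃ A : F →L[ℝ] E, A = mfderiv 𝓘(ℝ, F) I f u := ⟨_, rfl⟩
  have hA' : A = mfderiv 𝓘(ℝ, F) I g u := hA.trans h.mfderiv_eq
  let Ω₁ : M → E [⋀^Fin 2]→L[ℝ] ℝ := fun x => Ω x
  have h1 : Ω₁ (f u) = Ω₁ (g u) := congrArg Ω₁ h.eq_of_nhds
  have h2 : formPullback Ω f u v w = Ω₁ (f u) ![A v, A w] := by
    rw [hA]; rfl
  have h3 : formPullback Ω g u v w = Ω₁ (g u) ![A v, A w] := by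
    rw [hA']; rfl
  rw [h2, h3, h1]

theorem formPullback_eq (Ω : DiffForm I M 2) {f : F → M} {u : F} {f' : F →L[ℝ] E}
    (h : HasMFDerivAt 𝓘(ℝ, F) I f u f') (v w : F) :
    formPullback Ω f u v w = (Ω (f u) : E [⋀^Fin 2]→L[ℝ] ℝ) ![f' v, f' w] := by
  obtain ⟨A, hA⟩ : ∃ A : F →L[ℝ] E, A = mfderiv 𝓘(ℝ, F) I f u := ⟨_, rfl⟩
  have hA' : A = f' := hA.trans h.mfderiv
  rw [← hA', hA]
  rfl

theorem IsSymplectomorphism.formPullback_comp {Ω : DiffForm I M 2} {Ω' : DiffForm I' M' 2}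
    {e : M ≃ M'} (h : IsSymplectomorphism Ω Ω' e) {f : F → M} {u : F}
    (hf : MDifferentiableAt 𝓘(ℝ, F) I f u) (v w : F) :
    formPullback Ω' (fun u' => e (f u')) u v w = formPullback Ω f u v w := by
  have h1 := (h.smooth.mdifferentiable (by simp) (f u)).hasMFDerivAt
  have h2 := HasMFDerivAt.comp u h1 hf.hasMFDerivAt
  rw [formPullback_eq Ω hf.hasMFDerivAt, ← h.pullback (f u)]
  refine (formPullback_eq Ω' h2 v w).trans ?_
  refine congrArg (Ω' (e (f u)) : E' [⋀^Fin 2]→L[ℝ] ℝ) ?_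
  funext i
  fin_cases i <;> rfl

/-- To check that a smooth map pulls one form back to another it is enough to do so in charts. -/
theorem compContinuousLinearMap_mfderiv_eq_of_formPullback {M : Type*} [TopologicalSpace M]
    [ChartedSpace E M] [IsManifold 𝓘(ℝ, E) 1 M]
    {Ω : DiffForm 𝓘(ℝ, E) M 2} {Ω' : DiffForm I' M' 2} {f : M → M'} {c : M}
    (hf : MDifferentiableAt 𝓘(ℝ, E) I' f c)
    (h : ∀ v w, formPullback Ω' (fun u => f ((extChartAt 𝓘(ℝ, E) c).symm u))
        (extChartAt 𝓘(ℝ, E) c c) v w =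
      formPullback Ω (fun u => (extChartAt 𝓘(ℝ, E) c).symm u) (extChartAt 𝓘(ℝ, E) c c) v w) :
    (Ω' (f c)).compContinuousLinearMap (mfderiv 𝓘(ℝ, E) I' f c) = Ω c := by
  have hc : (extChartAt 𝓘(ℝ, E) c).symm (extChartAt 𝓘(ℝ, E) c c) = c := extChartAt_to_inv c
  have h1 : HasMFDerivAt 𝓘(ℝ, E) 𝓘(ℝ, E) (extChartAt 𝓘(ℝ, E) c).symm (extChartAt 𝓘(ℝ, E) c c)
      (ContinuousLinearMap.id ℝ E) := by
    have := (((contMDiffOn_extChartAt_symm (I := 𝓘(ℝ, E)) (n := 1) c).contMDiffAt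
      (extChartAt_target_mem_nhds c)).mdifferentiableAt (by simp)).hasMFDerivAt
    have h2 := mfderiv_extChartAt_symm_self (E := E) c
    exact h2 ▸ this
  obtain ⟨A, hA⟩ : ∃ A : E →L[ℝ] E', A = mfderiv 𝓘(ℝ, E) I' f c := ⟨_, rfl⟩
  have h2 : HasMFDerivAt 𝓘(ℝ, E) I' f ((extChartAt 𝓘(ℝ, E) c).symm (extChartAt 𝓘(ℝ, E) c c))
      (A : E →L[ℝ] E') := by
    rw [hc, hA]; exact hf.hasMFDerivAt
  have h3 := HasMFDerivAt.comp _ h2 h1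
  refine ContinuousAlternatingMap.ext fun m => ?_
  have h4 := h (m 0) (m 1)
  have h5 : (fun x => (Ω' (f x) : E' [⋀^Fin 2]→L[ℝ] ℝ))
    ((extChartAt 𝓘(ℝ, E) c).symm (extChartAt 𝓘(ℝ, E) c c)) = Ω' (f c) := by rw [hc]
  have h6 : (fun x => (Ω x : E [⋀^Fin 2]→L[ℝ] ℝ))
    ((extChartAt 𝓘(ℝ, E) c).symm (extChartAt 𝓘(ℝ, E) c c)) = Ω c := by rw [hc]
  have h7 := (formPullback_eq Ω' h3 (m 0) (m 1)).symm.trans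
    (h4.trans (formPullback_eq Ω h1 (m 0) (m 1)))
  have h8 : (Ω' (f c) : E' [⋀^Fin 2]→L[ℝ] ℝ) ![A (m 0), A (m 1)] =
      (Ω c : E [⋀^Fin 2]→L[ℝ] ℝ) ![m 0, m 1] := by
    rw [← h5, ← h6]; exact h7
  rw [hA] at h8
  refine Eq.trans ?_ (h8.trans ?_)
  · refine congrArg (Ω' (f c) : E' [⋀^Fin 2]→L[ℝ] ℝ) ?_
    funext i
    fin_cases i <;> rfl
  · refine congrArg (Ω c : E [⋀^Fin 2]→L[ℝ] ℝ) ?_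
    funext i
    fin_cases i <;> rfl

end FormPullback

/-! ### Lifting smooth families -/

section Lift

variable {E : Type*} [NormedAddCommGroup E] [NormedSpace ℝ E]
  {G : Type*} [Group G] [TopologicalSpace G] [ChartedSpace E G] [LieGroup 𝓘(ℝ, E) ∞ G]
  {EH : Type*} [NormedAddCommGroup EH] [NormedSpace ℝ EH]
  {H : Subgroup G} [ChartedSpace EH H] {O : Set (EH →L[ℝ] ℝ)}
  {ES : Type*} [NormedAddCommGroup ES] [NormedSpace ℝ ES]
  {S : Type*} [TopologicalSpace S] [ChartedSpace ES S]
  {Ω : DiffForm 𝓘(ℝ, ES) S 2} {act : S → G → S} {J : S → E →L[ℝ] ℝ}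

variable (act J H O) in
/-- The quotient `S^O` for the subgroup `H`. -/
abbrev SubgroupReduction : Type _ :=
  OrbitSpace (fun s (h : H) => act s (h : G)) (fun s => restrictDual H (J s)) O

variable (act J H O) in
/-- The quotient `S^{(T*G)^O}`. -/
abbrev StageReduction : Type _ :=
  InducedSpace act J (ReducedCotangent.act (E := E) H O) (ReducedCotangent.moment H O)

variable {r : ℕ} [TopologicalSpace (ReducedCotangent (E := E) H O)]
  [ChartedSpace (EuclideanSpace ℝ (Fin r)) (ReducedCotangent (E := E) H O)]
  {ΩT : DiffForm (𝓡 r) (ReducedCotangent (E := E) H O) 2}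
  {k : ℕ}

section Manifold

variable {N : Type*} [TopologicalSpace N] [ChartedSpace (EuclideanSpace ℝ (Fin k)) N]

theorem contMDiffOn_stagePoint_fst (hS : IsStronglyHamiltonian Ω act J) (x : G)
    {V : Set N} {f : N → {s : S // restrictDual H (J s) ∈ O}}
    (hf : ContMDiffOn (𝓡 k) 𝓘(ℝ, ES) ∞ (fun q => (f q).1) V) :
    ContMDiffOn (𝓡 k) 𝓘(ℝ, ES) ∞ (fun q => (stagePoint hS x (f q)).1.1) V :=
  (hS.contMDiff_act_left x⁻¹).comp_contMDiffOn hf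

theorem contMDiffOn_stagePoint_snd [IsManifold (𝓡 k) ∞ N] (hS : IsStronglyHamiltonian Ω act J)
    (hT : IsOrbitReduction (cotangentForm E G) (cotangentAct H) (momentR H) O ΩT) (x : G)
    {V : Set N} (hV : IsOpen V) {f : N → {s : S // restrictDual H (J s) ∈ O}}
    (hf : ContMDiffOn (𝓡 k) 𝓘(ℝ, ES) ∞ (fun q => (f q).1) V)
    (hθ : IsSmoothIntoOrbit H (F := EuclideanSpace ℝ (Fin k)) O
      (fun q => restrictDual H (J (f q).1)) V) :
    ContMDiffOn (𝓡 k) (𝓡 r) ∞ (fun q => (stagePoint hS x (f q)).1.2) V :=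
  hT.contMDiffOn_mk hV (f := fun q => ⟨(x, J (f q).1), (f q).2⟩)
    (contMDiffOn_const.prodMk (hS.smooth_J.comp_contMDiffOn hf)) hθ

/-- A local section σ of J_R⁻¹(O) → (T*G)^O turns the component z of a family (s, z) into (x, p) =
σ(z), and then J(s) = xp gives J(sx) = p. So sx is a smooth family in J_H⁻¹(O) representing the same
class, and its 𝔥-moment is smooth into O because that of σ is. The prescribed initial value c fixes
which x occurs at the base point. -/
theorem exists_stageLift (hS : IsStronglyHamiltonian Ω act J)
    (hT : IsOrbitReduction (cotangentForm E G) (cotangentAct H) (momentR H) O ΩT)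
    {V : Set N} (hV : IsOpen V) {f : N → {q : S × ReducedCotangent (E := E) H O //
      J q.1 = ReducedCotangent.moment H O q.2}}
    (hf₁ : ContMDiffOn (𝓡 k) 𝓘(ℝ, ES) ∞ (fun q => (f q).1.1) V)
    (hf₂ : ContMDiffOn (𝓡 k) (𝓡 r) ∞ (fun q => (f q).1.2) V)
    {q₀ : N} (hq₀ : q₀ ∈ V) {c : {z : Cotangent E G // momentR H z ∈ O}}
    (hc : (f q₀).1.2 = OrbitSpace.mk (cotangentAct H) (momentR H) O c) :
    ∃ V' ⊆ V, IsOpen V' ∧ q₀ ∈ V' ∧ ∃ (g : N → {z : Cotangent E G // momentR H z ∈ O})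
      (f' : N → {s : S // restrictDual H (J s) ∈ O}), g q₀ = c ∧
      ContMDiffOn (𝓡 k) (𝓘(ℝ, E).prod 𝓘(ℝ, E →L[ℝ] ℝ)) ∞ (fun q => (g q).1) V' ∧
      ContMDiffOn (𝓡 k) 𝓘(ℝ, ES) ∞ (fun q => (f' q).1) V' ∧
      IsSmoothIntoOrbit H (F := EuclideanSpace ℝ (Fin k)) O
        (fun q => restrictDual H (J (f' q).1)) V' ∧
      ∀ q ∈ V', OrbitSpace.mk (cotangentAct H) (momentR H) O (g q) = (f q).1.2 ∧
        (f' q).1 = act (f q).1.1 (g q).1.1 ∧ J (f' q).1 = (g q).1.2 ∧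
        InducedSpace.mk act J (ReducedCotangent.act (E := E) H O) (ReducedCotangent.moment H O)
          (f q) = stageMap hS (OrbitSpace.mk _ _ O (f' q)) := by
  classical
  obtain ⟨VT, hVT, hcVT, σ, hσ, hσθ, hσc, hσmk⟩ := hT.sections c
  have hVo : IsOpen (V ∩ (fun q => (f q).1.2) ⁻¹' VT) :=
    hf₂.continuousOn.isOpen_inter_preimage hV hVT
  have hmk : ∀ q ∈ V ∩ (fun q => (f q).1.2) ⁻¹' VT,
      OrbitSpace.mk (cotangentAct H) (momentR H) O (σ (f q).1.2) = (f q).1.2 :=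
    fun q hq => hσmk _ hq.2
  have hJ : ∀ q ∈ V ∩ (fun q => (f q).1.2) ⁻¹' VT,
      J (act (f q).1.1 (σ (f q).1.2).1.1) = (σ (f q).1.2).1.2 := by
    intro q hq
    refine hS.moment_act_eq ((f q).2.trans ?_)
    exact (congrArg (ReducedCotangent.moment H O) (hmk q hq)).symm
  have hin : ∀ q ∈ V ∩ (fun q => (f q).1.2) ⁻¹' VT,
      restrictDual H (J (act (f q).1.1 (σ (f q).1.2).1.1)) ∈ O := by
    intro q hq
    rw [hJ q hq]
    exact (σ (f q).1.2).2
  have hq₀' : q₀ ∈ V ∩ (fun q => (f q).1.2) ⁻¹' VT := ⟨hq₀, by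
    rw [mem_preimage, hc]; exact hcVT⟩
  -- Off the neighbourhood sx may leave J_H⁻¹(O); whenever it does, the value at q₀ serves as a
  -- default.
  obtain ⟨f', hf'⟩ : ∃ f' : N → {s : S // restrictDual H (J s) ∈ O},
      ∀ q ∈ V ∩ (fun q => (f q).1.2) ⁻¹' VT, (f' q).1 = act (f q).1.1 (σ (f q).1.2).1.1 :=
    ⟨fun q => if h : restrictDual H (J (act (f q).1.1 (σ (f q).1.2).1.1)) ∈ O then ⟨_, h⟩
      else ⟨_, hin q₀ hq₀'⟩, fun q hq => by simp only [hin q hq, dite_true]⟩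
  have hg : ContMDiffOn (𝓡 k) (𝓘(ℝ, E).prod 𝓘(ℝ, E →L[ℝ] ℝ)) ∞ (fun q => (σ (f q).1.2).1)
      (V ∩ (fun q => (f q).1.2) ⁻¹' VT) :=
    hσ.comp (hf₂.mono inter_subset_left) (fun _ h => h.2)
  refine ⟨_, inter_subset_left, hVo, hq₀', fun q => σ (f q).1.2, f', ?_, hg, ?_, ?_, ?_⟩
  · show σ (f q₀).1.2 = c
    rw [hc, hσc]
  · refine ContMDiffOn.congr ?_ hf'
    exact hS.smooth_act.comp_contMDiffOn
      ((hf₁.mono inter_subset_left).prodMk (contMDiff_fst.comp_contMDiffOn hg))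
  · refine (hσθ.comp hVo (hf₂.mono inter_subset_left) (fun _ h => h.2)).congr hVo subset_rfl ?_
    intro q hq
    rw [hf' q hq, hJ q hq]
    rfl
  · intro q hq
    refine ⟨hmk q hq, hf' q hq, by rw [hf' q hq, hJ q hq], ?_⟩
    have h1 : f' q = ⟨act (f q).1.1 (σ (f q).1.2).1.1, hin q hq⟩ := Subtype.ext (hf' q hq)
    have h2 : (f q).1.2 = ReducedCotangent.mk H O (σ (f q).1.2).1.1 (σ (f q).1.2).1.2
      (σ (f q).1.2).2 := (hmk q hq).symm
    rw [h1, ← mk_eq_stageMap hS (σ (f q).1.2).2 (by rw [← h2]; exact (f q).2) (hin q hq)]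
    congr 1
    exact Subtype.ext (Prod.ext rfl h2)

end Manifold

variable [CompleteSpace E]

/-- The family (1, J(t)) has no velocity in the direction of G, so dθ_L vanishes along it and only
the orbit form remains. -/
theorem formPullback_stagePoint_snd (hS : IsStronglyHamiltonian Ω act J)
    (hT : IsOrbitReduction (cotangentForm E G) (cotangentAct H) (momentR H) O ΩT)
    {U : Set (EuclideanSpace ℝ (Fin k))} (hU : IsOpen U)
    {f : EuclideanSpace ℝ (Fin k) → {s : S // restrictDual H (J s) ∈ O}}
    (hf : ContMDiffOn (𝓡 k) 𝓘(ℝ, ES) ∞ (fun q => (f q).1) U)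
    (hθ : IsSmoothIntoOrbit H (F := EuclideanSpace ℝ (Fin k)) O
      (fun q => restrictDual H (J (f q).1)) U) {u : EuclideanSpace ℝ (Fin k)} (hu : u ∈ U)
    (v w : EuclideanSpace ℝ (Fin k)) {ξ η : EH}
    (hξ : IsCoadVector H ξ (restrictDual H (J (f u).1))
      (fderiv ℝ (fun u' => restrictDual H (J (f u').1)) u v))
    (hη : IsCoadVector H η (restrictDual H (J (f u).1))
      (fderiv ℝ (fun u' => restrictDual H (J (f u').1)) u w)) :
    formPullback ΩT (fun u' => (stagePoint hS 1 (f u')).1.2) u v w =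
      -(restrictDual H (J (f u).1)) (lieBr H ξ η) := by
  have hJ : ContMDiffOn (𝓡 k) 𝓘(ℝ, E →L[ℝ] ℝ) ∞ (fun u' => J (f u').1) U :=
    hS.smooth_J.comp_contMDiffOn hf
  have h1 := hT.pullback k U hU (fun q => ⟨((1 : G), J (f q).1), (f q).2⟩)
    (contMDiffOn_const.prodMk hJ) hθ u hu v w ξ η hξ hη
  obtain ⟨D, hD⟩ : ∃ D : EuclideanSpace ℝ (Fin k) →L[ℝ] (E →L[ℝ] ℝ),
    HasMFDerivAt (𝓡 k) 𝓘(ℝ, E →L[ℝ] ℝ) (fun u' => J (f u').1) u D :=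
    ⟨_, ((hJ.contMDiffAt (hU.mem_nhds hu)).mdifferentiableAt (by simp)).hasMFDerivAt⟩
  have h2 := formPullback_eq (cotangentForm E G)
    ((hasMFDerivAt_const (I := 𝓡 k) (I' := 𝓘(ℝ, E)) (1 : G) u).prodMk hD) v w
  obtain ⟨l, hl⟩ : ∃ l : E →L[ℝ] E, l = leftTriv (1 : G) := ⟨_, rfl⟩
  have h3 : (cotangentForm E G (1, J (f u).1) : (E × (E →L[ℝ] ℝ)) [⋀^Fin 2]→L[ℝ] ℝ)
      ![(0, D v), (0, D w)] = D v (l 0) - D w (l 0) - J (f u).1 (lieBr G (l 0) (l 0)) := by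
    rw [hl]
    exact cotangentForm_apply (1, J (f u).1) 0 0 (D v) (D w)
  have h4 : lieBr G (0 : E) (0 : E) = 0 :=
    (GroupLieAlgebra.bracket_def _ _).trans (congrFun VectorField.mlieBracket_self 1)
  refine h1.trans ?_
  refine (congrArg (· + _) (h2.trans h3)).trans ?_
  rw [map_zero, h4]
  simp only [map_zero, sub_zero, zero_add]
  rfl

/-- The core of the comparison of forms. The form on (T*G)^O pulls back to dθ_L along (x, p) plus
the orbit form, and `IsStronglyHamiltonian.apply_deriv_act` absorbs dθ_L into the passage from s to
sx. -/
theorem formPullback_stageLift (hS : IsStronglyHamiltonian Ω act J)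
    (hT : IsOrbitReduction (cotangentForm E G) (cotangentAct H) (momentR H) O ΩT)
    {U : Set (EuclideanSpace ℝ (Fin k))} (hU : IsOpen U)
    {f : EuclideanSpace ℝ (Fin k) → {q : S × ReducedCotangent (E := E) H O //
      J q.1 = ReducedCotangent.moment H O q.2}}
    {g : EuclideanSpace ℝ (Fin k) → {z : Cotangent E G // momentR H z ∈ O}}
    {f' : EuclideanSpace ℝ (Fin k) → {s : S // restrictDual H (J s) ∈ O}}
    (hf₁ : ContMDiffOn (𝓡 k) 𝓘(ℝ, ES) ∞ (fun q => (f q).1.1) U)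
    (hg : ContMDiffOn (𝓡 k) (𝓘(ℝ, E).prod 𝓘(ℝ, E →L[ℝ] ℝ)) ∞ (fun q => (g q).1) U)
    (hf' : ContMDiffOn (𝓡 k) 𝓘(ℝ, ES) ∞ (fun q => (f' q).1) U)
    (hθ : IsSmoothIntoOrbit H (F := EuclideanSpace ℝ (Fin k)) O
        (fun q => restrictDual H (J (f' q).1)) U)
    (hmk : ∀ q ∈ U, OrbitSpace.mk (cotangentAct H) (momentR H) O (g q) = (f q).1.2)
    (hact : ∀ q ∈ U, (f' q).1 = act (f q).1.1 (g q).1.1)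
    (hJ : ∀ q ∈ U, J (f' q).1 = (g q).1.2) {u : EuclideanSpace ℝ (Fin k)} (hu : u ∈ U)
    (v w : EuclideanSpace ℝ (Fin k)) {ξ η : EH}
    (hξ : IsCoadVector H ξ (restrictDual H (J (f' u).1))
      (fderiv ℝ (fun u' => restrictDual H (J (f' u').1)) u v))
    (hη : IsCoadVector H η (restrictDual H (J (f' u).1))
      (fderiv ℝ (fun u' => restrictDual H (J (f' u').1)) u w)) :
    formPullback Ω (fun u' => (f u').1.1) u v w + formPullback ΩT (fun u' => (f u').1.2) u v w =
      formPullback Ω (fun u' => (f' u').1) u v w +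
        -(restrictDual H (J (f' u).1)) (lieBr H ξ η) := by
  have hUn := hU.mem_nhds hu
  have hθg : ∀ q ∈ U, (momentR H (g q).1 : EH →L[ℝ] ℝ) = restrictDual H (J (f' q).1) := by
    intro q hq
    rw [hJ q hq]
    rfl
  have hθe : (fun u' => (momentR H (g u').1 : EH →L[ℝ] ℝ)) =ᶠ[𝓝 u] fun u' => restrictDual H (J (f' u').1) := by
    filter_upwards [hUn] with q hq using hθg q hq
  have h1 := hT.pullback k U hU g hg (hθ.congr hU subset_rfl hθg) u hu v w ξ η
    (by rw [hθe.fderiv_eq, hθg u hu]; exact hξ) (by rw [hθe.fderiv_eq, hθg u hu]; exact hη)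
  have h2 : formPullback ΩT (fun u' => (f u').1.2) u v w =
      formPullback (cotangentForm E G) (fun u' => (g u').1) u v w +
        -(restrictDual H (J (f' u).1)) (lieBr H ξ η) := by
    rw [← hθg u hu]
    refine (formPullback_congr ΩT (g := fun u' => OrbitSpace.mk (cotangentAct H) (momentR H) O (g u'))
      ?_ v w).trans h1
    filter_upwards [hUn] with q hq using (hmk q hq).symm
  obtain ⟨X, hX⟩ : ∃ X : EuclideanSpace ℝ (Fin k) →L[ℝ] E,
      HasMFDerivAt (𝓡 k) 𝓘(ℝ, E) (fun u' => (g u').1.1) u X :=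
    ⟨_, (((contMDiff_fst.comp_contMDiffOn hg).contMDiffAt hUn).mdifferentiableAt
      (by simp)).hasMFDerivAt⟩
  obtain ⟨P, hP⟩ : ∃ P : EuclideanSpace ℝ (Fin k) →L[ℝ] (E →L[ℝ] ℝ),
      HasMFDerivAt (𝓡 k) 𝓘(ℝ, E →L[ℝ] ℝ) (fun u' => (g u').1.2) u P :=
    ⟨_, (((contMDiff_snd.comp_contMDiffOn hg).contMDiffAt hUn).mdifferentiableAt
      (by simp)).hasMFDerivAt⟩
  obtain ⟨A, hA⟩ : ∃ A : EuclideanSpace ℝ (Fin k) →L[ℝ] ES,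
      HasMFDerivAt (𝓡 k) 𝓘(ℝ, ES) (fun u' => (f u').1.1) u A :=
    ⟨_, ((hf₁.contMDiffAt hUn).mdifferentiableAt (by simp)).hasMFDerivAt⟩
  obtain ⟨A', hA'⟩ : ∃ A' : EuclideanSpace ℝ (Fin k) →L[ℝ] ES,
      HasMFDerivAt (𝓡 k) 𝓘(ℝ, ES) (fun u' => (f' u').1) u A' :=
    ⟨_, ((hf'.contMDiffAt hUn).mdifferentiableAt (by simp)).hasMFDerivAt⟩
  have hacte : (fun u' => act (f u').1.1 (g u').1.1) =ᶠ[𝓝 u] fun u' => (f' u').1 := by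
    filter_upwards [hUn] with q hq using (hact q hq).symm
  have hJe : (fun u' => J (act (f u').1.1 (g u').1.1)) =ᶠ[𝓝 u] fun u' => (g u').1.2 := by
    filter_upwards [hUn] with q hq
    rw [← hact q hq, hJ q hq]
  have hg' : HasMFDerivAt (𝓡 k) 𝓘(ℝ, ES) (fun u' => act (f u').1.1 (g u').1.1) u A' :=
    hA'.congr_of_eventuallyEq hacte
  -- As J(sx) = p near u, the curve (x, J(sx)) in T*G is the lift g itself.
  have h3 := hS.apply_deriv_act hA hX hg'
    (hasMFDerivAt_iff_hasFDerivAt.1 (hP.congr_of_eventuallyEq hJe)) v w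
  have h4 : formPullback Ω (fun u' => (f' u').1) u v w =
      (Ω (act (f u).1.1 (g u).1.1) : ES [⋀^Fin 2]→L[ℝ] ℝ) ![A' v, A' w] := by
    rw [← formPullback_eq Ω hg']
    exact formPullback_congr Ω hacte.symm v w
  have h5 := formPullback_eq (cotangentForm E G) (hX.prodMk hP) v w
  rw [hJe.eq_of_nhds] at h3
  rw [h2, h4, h3, formPullback_eq Ω hA]
  rw [show formPullback (cotangentForm E G) (fun u' => (g u').1) u v w = _ from h5, ← add_assoc]
  rfl

end Lift

/-! ### Comparison of the two quotients -/

section Stages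

variable {E : Type*} [NormedAddCommGroup E] [NormedSpace ℝ E]
  {G : Type*} [Group G] [TopologicalSpace G] [ChartedSpace E G] [LieGroup 𝓘(ℝ, E) ∞ G]
  {EH : Type*} [NormedAddCommGroup EH] [NormedSpace ℝ EH]
  {H : Subgroup G} [ChartedSpace EH H] {O : Set (EH →L[ℝ] ℝ)}
  {ES : Type*} [NormedAddCommGroup ES] [NormedSpace ℝ ES]
  {S : Type*} [TopologicalSpace S] [ChartedSpace ES S]
  {Ω : DiffForm 𝓘(ℝ, ES) S 2} {act : S → G → S} {J : S → E →L[ℝ] ℝ}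

/-- The bijection `W : [s, [x, p]_H]_G ↦ [s x]_H`. -/
def stageEquiv (hS : IsStronglyHamiltonian Ω act J) :
    StageReduction H O act J ≃ SubgroupReduction H O act J :=
  -- W itself would have to be defined on a quotient built over another quotient; its inverse needs
  -- a single compatibility check.
  (Equiv.ofBijective (stageMap hS) (bijective_stageMap hS)).symm

theorem stageEquiv_symm_apply (hS : IsStronglyHamiltonian Ω act J)
    (a : SubgroupReduction H O act J) : (stageEquiv hS).symm a = stageMap hS a := rfl

theorem stageEquiv_eq_iff (hS : IsStronglyHamiltonian Ω act J) {c : StageReduction H O act J}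
    {a : SubgroupReduction H O act J} : stageEquiv hS c = a ↔ c = stageMap hS a :=
  (Equiv.eq_symm_apply _).symm

theorem stagePoint_eq (hS : IsStronglyHamiltonian Ω act J) {s : S} {x : G} {p : E →L[ℝ] ℝ}
    (hp : restrictDual H p ∈ O)
    (hs : J s = ReducedCotangent.moment H O (ReducedCotangent.mk H O x p hp))
    (hsx : restrictDual H (J (act s x)) ∈ O) :
    stagePoint hS x ⟨act s x, hsx⟩ = ⟨(s, ReducedCotangent.mk H O x p hp), hs⟩ := by
  have hJ := hS.moment_act_eq (hs.trans (ReducedCotangent.moment_mk x p hp))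
  simp only [stagePoint, ← hS.act_mul, mul_inv_cancel, hS.act_one, hJ]

theorem contDiffOn_restrictDual {k : ℕ} (hS : IsStronglyHamiltonian Ω act J)
    {U : Set (EuclideanSpace ℝ (Fin k))}
    {f : EuclideanSpace ℝ (Fin k) → {s : S // restrictDual H (J s) ∈ O}}
    (hf : ContMDiffOn (𝓡 k) 𝓘(ℝ, ES) ∞ (fun q => (f q).1) U) :
    ContDiffOn ℝ ∞ (fun u => (restrictDual H (J (f u).1) : EH →L[ℝ] ℝ)) U :=
  (((ContinuousLinearMap.compL ℝ EH E ℝ).flip (lieIncl H)).contDiff).comp_contDiffOn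
    (contMDiffOn_iff_contDiffOn.1 (hS.smooth_J.comp_contMDiffOn hf))

variable [LieGroup 𝓘(ℝ, EH) ∞ H] [CompleteSpace E]
  {r : ℕ} [TopologicalSpace (ReducedCotangent (E := E) H O)]
  [ChartedSpace (EuclideanSpace ℝ (Fin r)) (ReducedCotangent (E := E) H O)]
  {ΩT : DiffForm (𝓡 r) (ReducedCotangent (E := E) H O) 2}

variable {m n : ℕ} [TopologicalSpace (StageReduction H O act J)]
  [ChartedSpace (EuclideanSpace ℝ (Fin m)) (StageReduction H O act J)]
  [TopologicalSpace (SubgroupReduction H O act J)]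
  [ChartedSpace (EuclideanSpace ℝ (Fin n)) (SubgroupReduction H O act J)]
  {ΩI : DiffForm (𝓡 m) (StageReduction H O act J) 2}
  {ΩR : DiffForm (𝓡 n) (SubgroupReduction H O act J) 2}

/-- Locally, W is a section of the projection from the fibre product, then the lift s ↦ sx, then the
projection to S^O; its inverse is a section of J_H⁻¹(O), then t ↦ (t, [1, J(t)]_H), then the other
projection. The forms are compared along the first composite, parametrized by a chart. -/
theorem isSymplectomorphism_stageEquiv (hS : IsStronglyHamiltonian Ω act J)
    (hT : IsOrbitReduction (cotangentForm E G) (cotangentAct H) (momentR H) O ΩT)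
    (hI : IsInduction Ω act J ΩT (ReducedCotangent.act (E := E) H O)
      (ReducedCotangent.moment H O) ΩI)
    (hR : IsOrbitReduction Ω (fun s (h : H) => act s (h : G)) (fun s => restrictDual H (J s)) O
      ΩR) :
    IsSymplectomorphism ΩI ΩR (stageEquiv hS) := by
  have := hI.isManifold
  have := hR.isManifold
  have : IsManifold (𝓡 m) 1 (StageReduction H O act J) :=
    IsManifold.of_le (n := ∞) (by norm_cast)
  have hW : ContMDiff (𝓡 m) (𝓡 n) ∞ (stageEquiv (H := H) (O := O) hS) := by
    intro q
    obtain ⟨a, rfl⟩ := Quot.exists_rep q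
    obtain ⟨V, hV, hqV, σ, hσ₁, hσ₂, hσc, hσ⟩ := hI.sections a
    obtain ⟨c, hc⟩ := Quot.exists_rep a.1.2
    obtain ⟨V', hV'V, hV', hqV', g, f', -, hg, hf', hθ, hall⟩ := exists_stageLift hS hT hV hσ₁ hσ₂
      hqV (c := c) (by rw [hσc]; exact hc.symm)
    refine ((hR.contMDiffOn_mk hV' hf' hθ).congr ?_).contMDiffAt (hV'.mem_nhds hqV')
    intro q hq
    rw [stageEquiv_eq_iff, ← (hall q hq).2.2.2, hσ q (hV'V hq)]
  have hW' : ContMDiff (𝓡 n) (𝓡 m) ∞ (stageEquiv (H := H) (O := O) hS).symm := by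
    intro q
    obtain ⟨a, rfl⟩ := Quot.exists_rep q
    obtain ⟨V, hV, hqV, σ, hσ₁, hσ₂, hσc, hσ⟩ := hR.sections a
    refine ((hI.contMDiffOn_mk hV (f := fun q => stagePoint hS 1 (σ q))
      (contMDiffOn_stagePoint_fst hS 1 hσ₁)
      (contMDiffOn_stagePoint_snd hS hT 1 hV hσ₁ hσ₂)).congr ?_).contMDiffAt (hV.mem_nhds hqV)
    intro q hq
    rw [mk_stagePoint, hσ q hq]
    rfl
  refine ⟨hW, hW', fun q => ?_⟩
  refine compContinuousLinearMap_mfderiv_eq_of_formPullback (hW.mdifferentiable (by simp) q)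
    fun v w => ?_
  obtain ⟨a, ha⟩ := Quot.exists_rep q
  obtain ⟨V, hV, hqV, σ, hσ₁, hσ₂, hσc, hσ⟩ := hI.sections a
  have hqV : q ∈ V := ha ▸ hqV
  have hσc : σ q = a := by rw [← ha]; exact hσc
  obtain ⟨c, hc⟩ := Quot.exists_rep a.1.2
  obtain ⟨V', hV'V, hV', hqV', g, f', -, hg, hf', hθ, hall⟩ := exists_stageLift hS hT hV hσ₁ hσ₂
    hqV (c := c) (by rw [hσc]; exact hc.symm)
  let φ := extChartAt (𝓡 m) q
  obtain ⟨U, hUdef⟩ : ∃ U, U = φ.target ∩ φ.symm ⁻¹' V' := ⟨_, rfl⟩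
  have hU : IsOpen U := hUdef ▸ isOpen_extChartAt_symm_preimage hV' q
  have huU : φ q ∈ U := by
    rw [hUdef]
    exact ⟨mem_extChartAt_target q, by
      rw [mem_preimage, extChartAt_to_inv]; exact hqV'⟩
  have hUV' : ∀ u ∈ U, φ.symm u ∈ V' := fun u hu => (hUdef ▸ hu : _ ∈ φ.target ∩ _).2
  have hφ : ContMDiffOn (𝓡 m) (𝓡 m) ∞ φ.symm U :=
    (contMDiffOn_extChartAt_symm q).mono (hUdef ▸ inter_subset_left)
  have hθ' := hθ.comp hU hφ hUV'
  have hf'' : ContMDiffOn (𝓡 m) 𝓘(ℝ, ES) ∞ (fun u => (f' (φ.symm u)).1) U := hf'.comp hφ hUV'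
  have hd := ((contDiffOn_restrictDual hS hf'').contDiffAt (hU.mem_nhds huU)).differentiableAt
    (by simp)
  -- The pull-back condition for S^O applies only to velocities presented as ad*_ξ θ, so such
  -- presentations must be produced.
  obtain ⟨ξ, hξ⟩ := hθ'.exists_isCoadVector huU hd v
  obtain ⟨η, hη⟩ := hθ'.exists_isCoadVector huU hd w
  have h1 := hI.pullback m U hU (fun u => σ (φ.symm u))
    ((hσ₁.mono hV'V).comp hφ hUV') ((hσ₂.mono hV'V).comp hφ hUV') _ huU v w
  have h2 := hR.pullback m U hU (fun u => f' (φ.symm u)) hf'' hθ' _ huU v w ξ η hξ hη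
  have h3 := formPullback_stageLift hS hT hU (f := fun u => σ (φ.symm u))
    (g := fun u => g (φ.symm u)) (f' := fun u => f' (φ.symm u)) ((hσ₁.mono hV'V).comp hφ hUV')
    (hg.comp hφ hUV') hf'' hθ' (fun u hu => (hall _ (hUV' u hu)).1)
    (fun u hu => (hall _ (hUV' u hu)).2.1) (fun u hu => (hall _ (hUV' u hu)).2.2.1) huU v w hξ hη
  have h4 := (formPullback_congr ΩR (f := fun u => stageEquiv hS (φ.symm u))
    (g := fun u => OrbitSpace.mk (fun s (h : H) => act s (h : G)) (fun s => restrictDual H (J s)) O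
      (f' (φ.symm u))) (by
      filter_upwards [hU.mem_nhds huU] with u hu
      rw [stageEquiv_eq_iff, ← (hall _ (hUV' u hu)).2.2.2, hσ _ (hV'V (hUV' u hu))]) v w).trans h2
  have h5 := (formPullback_congr ΩI (f := fun u => φ.symm u) (g := fun u => InducedSpace.mk act J
    (ReducedCotangent.act (E := E) H O) (ReducedCotangent.moment H O) (σ (φ.symm u))) (by
      filter_upwards [hU.mem_nhds huU] with u hu
      rw [hσ _ (hV'V (hUV' u hu))]) v w).trans h1
  exact h4.trans (h3.symm.trans h5.symm)

end Stages

/-! ### Existence of one reduced structure from the other. -/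

section Transport

variable {E : Type*} [NormedAddCommGroup E] [NormedSpace ℝ E]
  {G : Type*} [Group G] [TopologicalSpace G] [ChartedSpace E G] [LieGroup 𝓘(ℝ, E) ∞ G]
  {EH : Type*} [NormedAddCommGroup EH] [NormedSpace ℝ EH]
  {H : Subgroup G} [ChartedSpace EH H] {O : Set (EH →L[ℝ] ℝ)}
  {ES : Type*} [NormedAddCommGroup ES] [NormedSpace ℝ ES]
  {S : Type*} [TopologicalSpace S] [ChartedSpace ES S]
  {Ω : DiffForm 𝓘(ℝ, ES) S 2} {act : S → G → S} {J : S → E →L[ℝ] ℝ}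
  [CompleteSpace E] {r : ℕ} [TopologicalSpace (ReducedCotangent (E := E) H O)]
  [ChartedSpace (EuclideanSpace ℝ (Fin r)) (ReducedCotangent (E := E) H O)]
  {ΩT : DiffForm (𝓡 r) (ReducedCotangent (E := E) H O) 2}

theorem HasInduction.hasOrbitReduction (hS : IsStronglyHamiltonian Ω act J)
    (hT : IsOrbitReduction (cotangentForm E G) (cotangentAct H) (momentR H) O ΩT)
    (h : HasInduction Ω act J ΩT (ReducedCotangent.act (E := E) H O)
      (ReducedCotangent.moment H O)) :
    HasOrbitReduction Ω (fun s (h : H) => act s (h : G)) (fun s => restrictDual H (J s)) O := by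
  obtain ⟨n, _, _, ΩI, hI⟩ := h
  have := hI.isManifold
  have := hI.t2Space
  have := hI.secondCountable
  obtain ⟨_, _, ΩR, hT2, hSC, hM, hsymp, he⟩ :=
    exists_symplectic_transport (stageEquiv (H := H) (O := O) hS).symm ΩI hI.symplectic
  have hmk : ∀ (k : ℕ) (U : Set (EuclideanSpace ℝ (Fin k))), IsOpen U →
      ∀ f : EuclideanSpace ℝ (Fin k) → {s : S // restrictDual H (J s) ∈ O},
      ContMDiffOn (𝓡 k) 𝓘(ℝ, ES) ∞ (fun u => (f u).1) U →
      IsSmoothIntoOrbit H (F := EuclideanSpace ℝ (Fin k)) O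
        (fun u => restrictDual H (J (f u).1)) U →
      ContMDiffOn (𝓡 k) (𝓡 n) ∞ (fun u => OrbitSpace.mk (fun s (h : H) => act s (h : G))
        (fun s => restrictDual H (J s)) O (f u)) U := by
    intro k U hU f hf hθ
    refine (he.smooth_symm.comp_contMDiffOn (hI.contMDiffOn_mk hU
      (f := fun q => stagePoint hS 1 (f q)) (contMDiffOn_stagePoint_fst hS 1 hf)
      (contMDiffOn_stagePoint_snd hS hT 1 hU hf hθ))).congr ?_
    intro u hu
    simp only [Function.comp]
    rw [mk_stagePoint]
    exact ((stageEquiv_eq_iff hS).2 rfl).symm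
  refine ⟨n, _, _, ΩR, hT2, hSC, hM, hsymp, hmk, ?_, ?_⟩
  · intro c
    obtain ⟨V, hV, hcV, σ, hσ₁, hσ₂, hσc, hσ⟩ := hI.sections (stagePoint hS 1 c)
    -- The lift starts at (1, J(c)), so the family sx starts at c itself and not merely at another
    -- point of its H-orbit.
    obtain ⟨V', hV'V, hV', hcV', g, f', hgc, hg, hf', hθ, hall⟩ := exists_stageLift hS hT hV
      hσ₁ hσ₂ hcV (c := ⟨(1, J c.1), c.2⟩) (by rw [hσc]; rfl)
    rw [mk_stagePoint] at hcV' hgc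
    refine ⟨(stageEquiv hS).symm ⁻¹' V', hV'.preimage he.smooth.continuous, hcV',
      fun q => f' ((stageEquiv hS).symm q), hf'.comp he.smooth.contMDiffOn subset_rfl,
      hθ.comp (hV'.preimage he.smooth.continuous) he.smooth.contMDiffOn (fun _ h => h), ?_, ?_⟩
    · refine Subtype.ext ?_
      refine (hall _ hcV').2.1.trans ?_
      rw [hgc, ← mk_stagePoint hS 1, hσc]
      simp only [stagePoint, inv_one, hS.act_one]
    · intro q hq
      have h1 := (hall _ hq).2.2.2
      rw [hσ _ (hV'V hq)] at h1
      exact ((bijective_stageMap hS).1 h1).symm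
  · intro k U hU f hf hθ u hu v w ξ η hξ hη
    have h1 := hI.pullback k U hU (fun u => stagePoint hS 1 (f u))
      (contMDiffOn_stagePoint_fst hS 1 hf) (contMDiffOn_stagePoint_snd hS hT 1 hU hf hθ) u hu v w
    have h2 := formPullback_stagePoint_snd hS hT hU hf hθ hu v w hξ hη
    have h3 := he.formPullback_comp (((hmk k U hU f hf hθ).contMDiffAt
      (hU.mem_nhds hu)).mdifferentiableAt (by simp)) v w
    have h4 := (formPullback_congr ΩI (f := fun u' => (stageEquiv hS).symm (OrbitSpace.mk
      (fun s (h : H) => act s (h : G)) (fun s => restrictDual H (J s)) O (f u')))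
      (g := fun u' => InducedSpace.mk act J (ReducedCotangent.act (E := E) H O)
        (ReducedCotangent.moment H O) (stagePoint hS 1 (f u')))
      (Eventually.of_forall fun u' => (mk_stagePoint hS 1 (f u')).symm) v w).trans h1
    have h5 := formPullback_congr Ω (f := fun u' => (stagePoint hS 1 (f u')).1.1)
      (g := fun u' => (f u').1) (u := u) (Eventually.of_forall fun u' => by
        simp only [stagePoint, inv_one, hS.act_one]) v w
    exact h3.symm.trans (h4.trans (congrArg₂ (· + ·) h5 h2))

variable [LieGroup 𝓘(ℝ, EH) ∞ H]

theorem HasOrbitReduction.hasInduction (hS : IsStronglyHamiltonian Ω act J)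
    (hT : IsOrbitReduction (cotangentForm E G) (cotangentAct H) (momentR H) O ΩT)
    (h : HasOrbitReduction Ω (fun s (h : H) => act s (h : G))
      (fun s => restrictDual H (J s)) O) :
    HasInduction Ω act J ΩT (ReducedCotangent.act (E := E) H O)
      (ReducedCotangent.moment H O) := by
  obtain ⟨n, _, _, ΩR, hR⟩ := h
  have := hR.isManifold
  have := hR.t2Space
  have := hR.secondCountable
  obtain ⟨_, _, ΩI, hT2, hSC, hM, hsymp, he⟩ :=
    exists_symplectic_transport (stageEquiv (H := H) (O := O) hS) ΩR hR.symplectic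
  have hmk : ∀ (k : ℕ) (U : Set (EuclideanSpace ℝ (Fin k))), IsOpen U →
      ∀ f : EuclideanSpace ℝ (Fin k) → {q : S × ReducedCotangent (E := E) H O //
        J q.1 = ReducedCotangent.moment H O q.2},
      ContMDiffOn (𝓡 k) 𝓘(ℝ, ES) ∞ (fun u => (f u).1.1) U →
      ContMDiffOn (𝓡 k) (𝓡 r) ∞ (fun u => (f u).1.2) U →
      ContMDiffOn (𝓡 k) (𝓡 n) ∞ (fun u => InducedSpace.mk act J
        (ReducedCotangent.act (E := E) H O) (ReducedCotangent.moment H O) (f u)) U := by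
    intro k U hU f hf₁ hf₂ u hu
    obtain ⟨c, hc⟩ := Quot.exists_rep (f u).1.2
    obtain ⟨V', hV'U, hV', huV', g, f', -, hg, hf', hθ, hall⟩ := exists_stageLift hS hT hU
      hf₁ hf₂ hu (c := c) hc.symm
    refine (((he.smooth_symm.comp_contMDiffOn (hR.contMDiffOn_mk hV' hf' hθ)).congr
      ?_).contMDiffAt (hV'.mem_nhds huV')).contMDiffWithinAt
    intro q hq
    exact (hall q hq).2.2.2
  refine ⟨n, _, _, ΩI, hT2, hSC, hM, hsymp, hmk, ?_, ?_⟩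
  · rintro ⟨⟨s, z⟩, hs⟩
    obtain ⟨x, p, hp, rfl⟩ := z.exists_rep
    have hsx : restrictDual H (J (act s x)) ∈ O := by
      rw [hS.moment_act_eq (hs.trans (ReducedCotangent.moment_mk x p hp))]; exact hp
    obtain ⟨V, hV, hcV, σ, hσ, hσθ, hσc, hσmk⟩ := hR.sections ⟨act s x, hsx⟩
    have hW : stageEquiv hS (InducedSpace.mk act J (ReducedCotangent.act (E := E) H O)
        (ReducedCotangent.moment H O) ⟨(s, ReducedCotangent.mk H O x p hp), hs⟩) =
        OrbitSpace.mk _ _ O ⟨act s x, hsx⟩ :=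
      (stageEquiv_eq_iff hS).2 (mk_eq_stageMap hS hp hs hsx)
    have hVo : IsOpen (stageEquiv (H := H) (O := O) hS ⁻¹' V) := hV.preimage he.smooth.continuous
    have hσ' := hσ.comp (he.smooth.contMDiffOn (s := stageEquiv hS ⁻¹' V)) subset_rfl
    have hσθ' := hσθ.comp hVo he.smooth.contMDiffOn (fun _ h => h)
    -- Keeping the fixed x of the given representative, instead of 1, makes the section pass through
    -- (s, [x,p]_H).
    refine ⟨_, hVo, by rw [mem_preimage, hW]; exact hcV,
      fun q => stagePoint hS x (σ (stageEquiv hS q)),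
      contMDiffOn_stagePoint_fst hS x hσ', contMDiffOn_stagePoint_snd hS hT x hVo hσ' hσθ', ?_, ?_⟩
    · simp only
      rw [hW, hσc, stagePoint_eq hS hp hs]
    · intro q hq
      rw [mk_stagePoint, hσmk _ hq, ← stageEquiv_symm_apply, Equiv.symm_apply_apply]
  · intro k U hU f hf₁ hf₂ u hu v w
    obtain ⟨c, hc⟩ := Quot.exists_rep (f u).1.2
    obtain ⟨V', hV'U, hV', huV', g, f', -, hg, hf', hθ, hall⟩ := exists_stageLift hS hT hU
      hf₁ hf₂ hu (c := c) hc.symm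
    have hd := ((contDiffOn_restrictDual hS hf').contDiffAt (hV'.mem_nhds huV')).differentiableAt
      (by simp)
    obtain ⟨ξ, hξ⟩ := hθ.exists_isCoadVector huV' hd v
    obtain ⟨η, hη⟩ := hθ.exists_isCoadVector huV' hd w
    have h1 := hR.pullback k V' hV' f' hf' hθ u huV' v w ξ η hξ hη
    have h2 := formPullback_stageLift hS hT hV' (hf₁.mono hV'U) hg hf' hθ
      (fun q hq => (hall q hq).1) (fun q hq => (hall q hq).2.1) (fun q hq => (hall q hq).2.2.1)
      huV' v w hξ hη
    have h3 := he.formPullback_comp (((hmk k U hU f hf₁ hf₂).contMDiffAt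
      (hU.mem_nhds hu)).mdifferentiableAt (by simp)) v w
    have h4 := (formPullback_congr ΩR (f := fun u' => stageEquiv hS (InducedSpace.mk act J
        (ReducedCotangent.act (E := E) H O) (ReducedCotangent.moment H O) (f u')))
      (g := fun u' => OrbitSpace.mk
      (fun s (h : H) => act s (h : G)) (fun s => restrictDual H (J s)) O (f' u')) (by
        filter_upwards [hV'.mem_nhds huV'] with q hq
        rw [stageEquiv_eq_iff, (hall q hq).2.2.2]) v w).trans h1
    exact h3.symm.trans (h4.trans h2.symm)

end Transport

end SymplecticInduction

end

/-! ### The corollary. -/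

open SymplecticInduction in
theorem corollary1
    -- the connected Lie group `G`
    {E : Type*} [NormedAddCommGroup E] [NormedSpace ℝ E] [FiniteDimensional ℝ E]
    {G : Type*} [Group G] [TopologicalSpace G] [T2Space G] [SecondCountableTopology G]
    [ChartedSpace E G] [LieGroup 𝓘(ℝ, E) ∞ G] [ConnectedSpace G]
    -- its closed connected subgroup `H`
    {EH : Type*} [NormedAddCommGroup EH] [NormedSpace ℝ EH] [FiniteDimensional ℝ EH]
    (H : Subgroup G) [ChartedSpace EH H] [LieGroup 𝓘(ℝ, EH) ∞ H] [ConnectedSpace H]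
    (hH : IsClosedLieSubgroup (E := E) (EH := EH) H)
    -- a coadjoint orbit of `H`
    (O : Set (EH →L[ℝ] ℝ)) (hO : IsCoadjointOrbit H O)
    -- the symplectic manifold `S` with its strongly Hamiltonian right `G`-action
    {ES : Type*} [NormedAddCommGroup ES] [NormedSpace ℝ ES] [FiniteDimensional ℝ ES]
    {S : Type*} [TopologicalSpace S] [T2Space S] [SecondCountableTopology S]
    [ChartedSpace ES S] [IsManifold 𝓘(ℝ, ES) ∞ S]
    (Ω : DiffForm 𝓘(ℝ, ES) S 2) (hΩ : IsSymplectic Ω)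
    (act : S → G → S) (J : S → E →L[ℝ] ℝ) (hS : IsStronglyHamiltonian Ω act J)
    -- the reduced symplectic manifold `(T*G)^O = J_R⁻¹(O) / H`
    {r : ℕ} [TopologicalSpace (ReducedCotangent (E := E) H O)]
    [ChartedSpace (EuclideanSpace ℝ (Fin r)) (ReducedCotangent (E := E) H O)]
    (ΩT : DiffForm (𝓡 r) (ReducedCotangent (E := E) H O) 2)
    (hT : IsOrbitReduction (cotangentForm E G) (cotangentAct H) (momentR H) O ΩT) :
    -- the map `W` from `S^{(T*G)^O} = (S *_{𝔤*} (T*G)^O) / G` to `S^O = J_H⁻¹(O) / H`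
    ∃ W : InducedSpace act J (ReducedCotangent.act (E := E) H O) (ReducedCotangent.moment H O) ≃
        OrbitSpace (fun s (h : H) => act s (h : G)) (fun s => restrictDual H (J s)) O,
      -- `W [s, [x, p]_H]_G = [s x]_H`
      (∀ (s : S) (x : G) (p : E →L[ℝ] ℝ) (hp : restrictDual H p ∈ O)
        (hs : J s = ReducedCotangent.moment H O (ReducedCotangent.mk H O x p hp)),
        ∃ hsx : restrictDual H (J (act s x)) ∈ O,
          W (InducedSpace.mk act J (ReducedCotangent.act (E := E) H O)
              (ReducedCotangent.moment H O) ⟨(s, ReducedCotangent.mk H O x p hp), hs⟩) =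
            OrbitSpace.mk (fun s (h : H) => act s (h : G)) (fun s => restrictDual H (J s)) O
              ⟨act s x, hsx⟩) ∧
      -- one of the two spaces is a symplectic manifold if and only if the other one is
      (HasInduction Ω act J ΩT (ReducedCotangent.act (E := E) H O) (ReducedCotangent.moment H O) ↔
        HasOrbitReduction Ω (fun s (h : H) => act s (h : G)) (fun s => restrictDual H (J s)) O) ∧
      -- and then `W` is a symplectomorphism
      (∀ (m n : ℕ)
        [TopologicalSpace (InducedSpace act J (ReducedCotangent.act (E := E) H O)
          (ReducedCotangent.moment H O))]
        [ChartedSpace (EuclideanSpace ℝ (Fin m)) (InducedSpace act J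
          (ReducedCotangent.act (E := E) H O) (ReducedCotangent.moment H O))]
        [TopologicalSpace (OrbitSpace (fun s (h : H) => act s (h : G))
          (fun s => restrictDual H (J s)) O)]
        [ChartedSpace (EuclideanSpace ℝ (Fin n)) (OrbitSpace (fun s (h : H) => act s (h : G))
          (fun s => restrictDual H (J s)) O)]
        (ΩI : DiffForm (𝓡 m) (InducedSpace act J (ReducedCotangent.act (E := E) H O)
          (ReducedCotangent.moment H O)) 2)
        (ΩR : DiffForm (𝓡 n) (OrbitSpace (fun s (h : H) => act s (h : G))
          (fun s => restrictDual H (J s)) O) 2),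
        IsInduction Ω act J ΩT (ReducedCotangent.act (E := E) H O)
          (ReducedCotangent.moment H O) ΩI →
        IsOrbitReduction Ω (fun s (h : H) => act s (h : G)) (fun s => restrictDual H (J s)) O ΩR →
        IsSymplectomorphism ΩI ΩR W) := by
  -- Completeness enters through the left-invariance of the bracket of left-invariant fields, hence
  -- through the Maurer-Cartan equation.
  have : CompleteSpace E := FiniteDimensional.complete ℝ E
  refine ⟨stageEquiv hS, ?_, ⟨fun h => h.hasOrbitReduction hS hT, fun h => h.hasInduction hS hT⟩,
    fun m n _ _ _ _ ΩI ΩR hI hR => isSymplectomorphism_stageEquiv hS hT hI hR⟩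
  intro s x p hp hs
  have hsx : restrictDual H (J (act s x)) ∈ O := by
    rw [hS.moment_act_eq (hs.trans (ReducedCotangent.moment_mk x p hp))]
    exact hp
  exact ⟨hsx, (stageEquiv_eq_iff hS).2 (mk_eq_stageMap hS hp hs hsx)⟩
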